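/- **Setting.** Let $V$ be a finite-dimensional real vector space, $\Gamma\subset V$ a lattice of full rank, and $X=[a_1,\dots,a_m]$ a list of nonzero elements of $\Gamma$ that spans $V$ and generates a pointed cone (the cone of nonnegative combinations of $X$ contains no line). Fix a scalar product $\langle\cdot,\cdot\rangle$ on $V$. A subspace of $V$ is *rational* if it is spanned by a sublist of $X$; let $S_X$ be the finite set of rational subspaces (it contains $\{0\}$ and $V$). For $\underline r\in S_X$ let $X\cap\underline r$ and $X\setminus\underline r$ be the sublists of those elements of $X$ that lie, respectively do not lie, in $\underline r$. For $\beta\in V$ let $p_{\underline r}\beta$ and $p_{\underline r^\perp}\beta$ be its orthogonal projections to $\underline r$ and $\underline r^\perp$. * For a sublist $Y$ of $X$, $\mathcal P_Y(\gamma)$ is the number of ways to write $\gamma\in\Gamma$ as $\sum_{a\in Y}k_a a$ with integers $k_a\ge 0$, and $B(Y)=\{\sum_{a\in Y}t_a a : 0\le t_a\le 1\}$. * A *tope* of $X\cap\underline r$ is a connected component of the complement in $\underline r$ of the union of the hyperplanes of $\underline r$ spanned by sublists of $X\cap\underline r$. * A vector $u\in\underline r^\perp$ is *regular* for $X\setminus\underline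 r$ if $\langle u,a\rangle\ne 0$ for all $a\in X\setminus\underline r$. A *regular face* $F$ for $X\setminus\underline r$ is a connected component of the set of these vectors. If $A$ and $B$ are the sublists of $X\setminus\underline r$ of the elements on which $F$ is positive, respectively negative, then $\mathcal P^{F}_{X\setminus\underline r}:\Gamma\to\mathbb Z$ is the function with generating series $$\sum_{\gamma\in\Gamma}\mathcal P^{F}_{X\setminus\underline r}(\gamma)e^\gamma=(-1)^{|B|}e^{-\sum_{b\in B}b}\prod_{a\in A}\Bigl(\sum_{k\ge 0}e^{ka}\Bigr)\prod_{b\in B}\Bigl(\sum_{k\ge 0}e^{-kb}\Bigr).$$ * A *quasi-polynomial* on $\Gamma\cap\underline r$ is a function that coincides with a polynomial on each coset of some subgroup of finite index. For a tope $\tau$ of $X\cap\underline r$, $(\mathcal P_{X\cap\underline r})^{\tau}$ denotes the integer-valued quasi-polynomial on $\Gamma\cap\underline r$ that coincides with $\mathcal P_{X\cap\underline r}$ at the lattice points of $\tau-B(X\cap\underline r)=\{t-b: t\in\tau,\ b\in B(X\cap\underline r)\}$; it is extended by $0$ to $\Gamma$. A vector $\beta\in V$ is *generic with respect to* $\underline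 r$ if $p_{\underline r}\beta$ lies in a tope of $X\cap\underline r$, denoted $\tau(p_{\underline r}\beta)$, and $p_{\underline r^\perp}\beta$ is regular for $X\setminus\underline r$; then $F^\beta_{\underline r}$ denotes the regular face for $X\setminus\underline r$ that contains $p_{\underline r^\perp}\beta$. **Theorem 3.15 (Paradan).** Let $\beta\in V$ be generic with respect to all rational subspaces $\underline r\in S_X$. Then for every $\underline r\in S_X$ the quasi-polynomial $(\mathcal P_{X\cap\underline r})^{\tau(p_{\underline r}\beta)}$ exists and is unique, the convolution below is well defined (for each $\gamma\in\Gamma$ only finitely many terms of its defining sum are nonzero), and $$\mathcal P_X=\sum_{\underline r\in S_X}\mathcal P^{-F^\beta_{\underline r}}_{X\setminus\underline r}*(\mathcal P_{X\cap\underline r})^{\tau(p_{\underline r}\beta)},$$ where $(f*g)(\gamma)=\sum_{\mu\in\Gamma}f(\mu)\,g(\gamma-\mu)$. -/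

import Mathlib

open scoped Pointwise

namespace PartFun

section

variable {V : Type*} [NormedAddCommGroup V] [InnerProductSpace ℝ V] [FiniteDimensional ℝ V]
  {Γ : Submodule ℤ V} {ι : Type*} [Fintype ι]

/-! Throughout, `V` is a Euclidean space (its inner product is the chosen scalar product), `Γ` is a
lattice in `V`, and a list of vectors of `Γ` is a finite family `a : ι → Γ`. A sublist is given by
the finite set `s` of the indices that are kept. -/

/-- The list generates a pointed cone: its cone of nonnegative real combinations has no line. -/
def GeneratesPointedCone (a : ι → Γ) : Prop :=
  (PointedCone.hull ℝ (Set.range fun i => (a i : V)) : ConvexCone ℝ V).Salient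

/-- The real subspace spanned by a sublist. -/
def spanOf (a : ι → Γ) (s : Finset ι) : Submodule ℝ V :=
  Submodule.span ℝ ((fun i => (a i : V)) '' (s : Set ι))

open Classical in
/-- The finite set `S_X` of rational subspaces: those spanned by a sublist of `X`. -/
noncomputable def rationalSubspaces (a : ι → Γ) : Finset (Submodule ℝ V) :=
  Finset.univ.image (spanOf a)

open Classical in
/-- The indices of the sublist `X ∩ r`. -/
noncomputable def inside (a : ι → Γ) (r : Submodule ℝ V) : Finset ι :=
  Finset.univ.filter fun i => (a i : V) ∈ r

open Classical in
/-- The indices of the sublist `X ∖ r`. -/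
noncomputable def outside (a : ι → Γ) (r : Submodule ℝ V) : Finset ι :=
  Finset.univ.filter fun i => (a i : V) ∉ r

/-- The number of ways to write `γ` as a combination, with coefficients in `ℕ`, of the vectors of
the sublist `s`. -/
noncomputable def partitionFunction (a : ι → Γ) (s : Finset ι) (γ : Γ) : ℤ :=
  (Set.ncard {k : ι → ℕ | (∀ i, i ∉ s → k i = 0) ∧ ∑ i ∈ s, k i • a i = γ} : ℤ)

/-- The zonotope of a sublist. -/
def zonotope (a : ι → Γ) (s : Finset ι) : Set V :=
  {v | ∃ t : ι → ℝ, (∀ i, 0 ≤ t i ∧ t i ≤ 1) ∧ v = ∑ i ∈ s, t i • (a i : V)}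

/-- The complement, in the space `W` spanned by the sublist `s`, of the union of the hyperplanes of
`W` that are spanned by sublists of `s`. -/
def topeDomain (a : ι → Γ) (s : Finset ι) : Set V :=
  {v | v ∈ spanOf a s ∧ ∀ t : Finset ι, t ⊆ s →
    Module.finrank ℝ (spanOf a t) + 1 = Module.finrank ℝ (spanOf a s) → v ∉ spanOf a t}

/-- The tope of the sublist `s` that contains `v`. -/
def tope (a : ι → Γ) (s : Finset ι) (v : V) : Set V :=
  connectedComponentIn (topeDomain a s) v

/-- The regular vectors for `X ∖ r`: the vectors of `rᗮ` not orthogonal to any vector of `X ∖ r`. -/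
def regularVectors (a : ι → Γ) (r : Submodule ℝ V) : Set V :=
  {u | u ∈ rᗮ ∧ ∀ i ∈ outside a r, inner ℝ u (a i : V) ≠ 0}

/-- The regular face for `X ∖ r` that contains `u`. -/
def regularFace (a : ι → Γ) (r : Submodule ℝ V) (u : V) : Set V :=
  connectedComponentIn (regularVectors a r) u

/-- `β` is generic with respect to `r`: its projection to `r` lies in a tope of `X ∩ r`, and its
projection to `rᗮ` is regular for `X ∖ r`. -/
def IsGeneric (a : ι → Γ) (r : Submodule ℝ V) (β : V) : Prop :=
  r.starProjection β ∈ topeDomain a (inside a r) ∧ rᗮ.starProjection β ∈ regularVectors a r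

open Classical in
/-- The indices in `s` of the vectors on which the face `F` is negative (the part `B`). -/
noncomputable def negIndices (a : ι → Γ) (s : Finset ι) (F : Set V) : Finset ι :=
  s.filter fun i => ∀ u ∈ F, inner ℝ u (a i : V) < 0

open Classical in
/-- The list obtained by reversing the vectors on which the face `F` is negative. -/
noncomputable def polarize (a : ι → Γ) (F : Set V) (i : ι) : Γ :=
  if ∀ u ∈ F, inner ℝ u (a i : V) < 0 then -a i else a i

/-- The function `P_s^F`, with generating series
`(-1)^|B| e^(-∑_B b) ∏_{c ∈ A} (∑_k e^(k c)) ∏_{b ∈ B} (∑_k e^(-k b))`, where `A` and `B` are the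
parts of the sublist `s` on which the face `F` is positive, respectively negative. -/
noncomputable def facePartition (a : ι → Γ) (s : Finset ι) (F : Set V) (γ : Γ) : ℤ :=
  (-1) ^ (negIndices a s F).card *
    partitionFunction (polarize a F) s (γ + ∑ i ∈ negIndices a s F, a i)

/-- The convolution of `f` and `g` is defined: every `γ` is in only finitely many ways a sum of an
element of the support of `f` and an element of the support of `g`. -/
def ConvolutionDefined (f g : Γ → ℤ) : Prop :=
  ∀ γ : Γ, {μ : Γ | f μ ≠ 0 ∧ g (γ - μ) ≠ 0}.Finite

/-- The convolution of two functions on the lattice. -/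
noncomputable def convolution (f g : Γ → ℤ) (γ : Γ) : ℤ :=
  ∑ᶠ μ : Γ, f μ * g (γ - μ)

/-- The lattice `Γ ∩ r`, as a subgroup of `Γ`. -/
def latticeIn (Γ : Submodule ℤ V) (r : Submodule ℝ V) : AddSubgroup Γ :=
  r.toAddSubgroup.comap Γ.subtype.toAddMonoidHom

/-- `q` is a quasi-polynomial on `Γ ∩ r`, extended by zero to `Γ`: on each coset in `Γ ∩ r` of
some subgroup of finite index, it is a polynomial (in linear functionals). -/
def IsQuasiPolynomial (r : Submodule ℝ V) (q : Γ → ℤ) : Prop :=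
  (∀ γ : Γ, (γ : V) ∉ r → q γ = 0) ∧
  ∃ L : AddSubgroup Γ, L ≤ latticeIn Γ r ∧ L.relIndex (latticeIn Γ r) ≠ 0 ∧
    ∀ c ∈ latticeIn Γ r, ∃ p : MvPolynomial (Module.Dual ℝ V) ℝ, ∀ l ∈ L,
      (q (c + l) : ℝ) = MvPolynomial.eval (fun φ : Module.Dual ℝ V => φ ((c + l : Γ) : V)) p

/-- `q` is a quasi-polynomial on `Γ ∩ r` (extended by zero) that coincides with `f` at the
lattice points of `τ - B(X ∩ r)`. -/
def IsTopePart (a : ι → Γ) (r : Submodule ℝ V) (τ : Set V) (f q : Γ → ℤ) : Prop :=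
  IsQuasiPolynomial r q ∧ ∀ γ : Γ, (γ : V) ∈ τ - zonotope a (inside a r) → q γ = f γ

/-- The function `f^τ`: the quasi-polynomial on `Γ ∩ r` that coincides with `f` on
`τ - B(X ∩ r)` (an arbitrary function if there is none). -/
noncomputable def topePart (a : ι → Γ) (r : Submodule ℝ V) (τ : Set V) (f : Γ → ℤ) : Γ → ℤ :=
  Classical.epsilon (IsTopePart a r τ f)

end

end PartFun

set_option linter.unusedSectionVars false

namespace PartFun

section

variable {V : Type*} [NormedAddCommGroup V] [InnerProductSpace ℝ V]
  {Γ : Submodule ℤ V} {ι : Type*}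

variable [Fintype ι] [DecidableEq ι]

/-- The list `b`, restricted to `s`, has no nontrivial relation with coefficients in `ℕ`. -/
def NoRelation {M : Type*} [AddCommMonoid M] (b : ι → M) (s : Finset ι) : Prop :=
  ∀ k : ι → ℕ, (∀ i, i ∉ s → k i = 0) → ∑ i ∈ s, k i • b i = 0 → k = 0

lemma NoRelation.mono {M : Type*} [AddCommMonoid M] {b : ι → M} {s t : Finset ι}
    (h : NoRelation b s) (hts : t ⊆ s) : NoRelation b t := by
  intro k hk h0
  refine h k (fun i hi => hk i fun hit => hi (hts hit)) ?_
  rw [← Finset.sum_subset hts, h0]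
  intro i _ hi
  simp [hk i hi]

lemma NoRelation.finite {M : Type*} [AddCommGroup M] {b : ι → M} {s : Finset ι}
    (h : NoRelation b s) (γ : M) :
    {k : ι → ℕ | (∀ i, i ∉ s → k i = 0) ∧ ∑ i ∈ s, k i • b i = γ}.Finite := by
  have hanti : IsAntichain (· ≤ ·)
      {k : ι → ℕ | (∀ i, i ∉ s → k i = 0) ∧ ∑ i ∈ s, k i • b i = γ} := by
    intro k hk l hl hne hle
    apply hne
    have h0 := h (fun i => l i - k i) (fun i hi => by simp [hl.1 i hi]) (by
      have : ∀ i ∈ s, (l i - k i) • b i = l i • b i - k i • b i := by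
        intro i _
        rw [sub_nsmul _ (hle i), sub_eq_add_neg]
      rw [Finset.sum_congr rfl this, Finset.sum_sub_distrib, hl.2, hk.2, sub_self])
    funext i
    have := congrFun h0 i
    have := hle i
    simp at *
    omega
  exact hanti.finite_of_partiallyWellOrderedOn (Set.isPWO_of_wellQuasiOrderedLE _)

lemma partitionFunction_sub {b : ι → Γ} {s : Finset ι} (h : NoRelation b s) {j : ι} (hj : j ∈ s)
    (γ : Γ) :
    partitionFunction b s γ - partitionFunction b s (γ - b j) =
      partitionFunction b (s.erase j) γ := by
  set A := {k : ι → ℕ | (∀ i, i ∉ s → k i = 0) ∧ ∑ i ∈ s, k i • b i = γ - b j} with hA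
  set B := {k : ι → ℕ | (∀ i, i ∉ s.erase j → k i = 0) ∧ ∑ i ∈ s.erase j, k i • b i = γ} with hB
  set f : (ι → ℕ) → (ι → ℕ) := fun k => k + Pi.single j 1 with hf
  have hfinj : Function.Injective f := fun k l hkl => add_right_cancel hkl
  have hunion : {k : ι → ℕ | (∀ i, i ∉ s → k i = 0) ∧ ∑ i ∈ s, k i • b i = γ} = f '' A ∪ B := by
    ext k
    simp only [Set.mem_union, Set.mem_image, Set.mem_ofPred_eq, hA, hB]
    constructor
    · rintro ⟨h1, h2⟩
      by_cases hk : k j = 0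
      · right
        refine ⟨fun i hi => ?_, ?_⟩
        · by_cases hij : i = j
          · rw [hij, hk]
          · exact h1 i fun hs => hi (Finset.mem_erase.2 ⟨hij, hs⟩)
        · rw [← h2, ← Finset.add_sum_erase s _ hj, hk, zero_smul, zero_add]
      · left
        have hk' : k = k - Pi.single j 1 + Pi.single j 1 := by
          funext i
          by_cases hij : i = j
          · subst hij; simp; omega
          · simp [hij]
        refine ⟨k - Pi.single j 1, ⟨fun i hi => by simp [h1 i hi], ?_⟩, hk'.symm⟩
        rw [← h2]
        conv_rhs => rw [hk']
        simp [add_smul, Finset.sum_add_distrib, Pi.single_apply, ite_smul, hj]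
    · rintro (⟨l, ⟨h1, h2⟩, rfl⟩ | ⟨h1, h2⟩)
      · refine ⟨fun i hi => ?_, ?_⟩
        · have : i ≠ j := fun h => hi (h ▸ hj)
          simp [hf, h1 i hi, this]
        · simp [hf, add_smul, Finset.sum_add_distrib, Pi.single_apply, ite_smul, hj, h2]
      · refine ⟨fun i hi => h1 i fun h => hi (Finset.mem_of_mem_erase h), ?_⟩
        rw [← Finset.add_sum_erase s _ hj, h1 j (by simp), zero_smul, zero_add, h2]
  have hdisj : Disjoint (f '' A) B := by
    rw [Set.disjoint_left]
    rintro _ ⟨k, _, rfl⟩ hk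
    have := hk.1 j (by simp)
    simp [hf] at this
  have hBfin : B.Finite := (h.mono (Finset.erase_subset j s)).finite γ
  have hAfin : (f '' A).Finite := (h.finite _).image f
  unfold partitionFunction
  rw [hunion, Set.ncard_union_eq hdisj hAfin hBfin, Set.ncard_image_of_injective _ hfinj]
  push_cast
  ring

lemma exists_of_partitionFunction_ne_zero {b : ι → Γ} {s : Finset ι} {γ : Γ}
    (h : partitionFunction b s γ ≠ 0) : ∃ k : ι → ℕ, γ = ∑ i ∈ s, k i • b i := by
  unfold partitionFunction at h
  obtain ⟨k, hk⟩ := Set.nonempty_of_ncard_ne_zero (by exact_mod_cast h)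
  exact ⟨k, hk.2.symm⟩

lemma partitionFunction_empty_zero (b : ι → Γ) : partitionFunction b ∅ 0 = 1 := by
  unfold partitionFunction
  have : {k : ι → ℕ | (∀ i, i ∉ (∅ : Finset ι) → k i = 0) ∧ ∑ i ∈ (∅ : Finset ι), k i • b i = 0}
      = {0} := by
    ext k
    simp [funext_iff]
  rw [this]
  simp

lemma partitionFunction_empty_of_ne (b : ι → Γ) {γ : Γ} (h : γ ≠ 0) :
    partitionFunction b ∅ γ = 0 := by
  by_contra hc
  obtain ⟨k, hk⟩ := exists_of_partitionFunction_ne_zero hc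
  exact h (by simpa using hk)

lemma noRelation_of_pointed {a : ι → Γ} (hne : ∀ i, a i ≠ 0) (hp : GeneratesPointedCone a)
    (s : Finset ι) : NoRelation a s := by
  intro k hk h0
  by_contra hk0
  obtain ⟨j, hj⟩ : ∃ j, k j ≠ 0 := by
    by_contra! h
    exact hk0 (funext h)
  have hjs : j ∈ s := by
    by_contra h
    exact hj (hk j h)
  set C := PointedCone.hull ℝ (Set.range fun i => (a i : V)) with hC
  have hmem : ∀ i, (a i : V) ∈ C := fun i => Submodule.subset_span ⟨i, rfl⟩
  have h1 : k j • (a j : V) ∈ C := C.nsmul_mem (hmem j) _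
  have h2 : ∑ i ∈ s.erase j, k i • (a i : V) ∈ C :=
    C.sum_mem fun i _ => C.nsmul_mem (hmem i) _
  have h0' : ∑ i ∈ s, k i • (a i : V) = 0 := by
    have := congrArg (Subtype.val : Γ → V) h0
    simpa using this
  rw [← Finset.add_sum_erase s _ hjs] at h0'
  have h3 : ∑ i ∈ s.erase j, k i • (a i : V) = -(k j • (a j : V)) := by
    rw [eq_neg_iff_add_eq_zero, add_comm, h0']
  rw [h3] at h2
  have hnz : k j • (a j : V) ≠ 0 := by
    have : (a j : V) ≠ 0 := by simpa using hne j
    rw [← Nat.cast_smul_eq_nsmul ℝ]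
    simp [hj, this]
  exact hp _ h1 hnz h2

lemma polarize_of_mem {a : ι → Γ} {s : Finset ι} {F : Set V} {j : ι}
    (hj : j ∈ negIndices a s F) : polarize a F j = -a j := by
  classical
  simp only [negIndices, Finset.mem_filter] at hj
  simp only [polarize]
  rw [if_pos hj.2]

lemma polarize_of_notMem {a : ι → Γ} {s : Finset ι} {F : Set V} {j : ι} (hjs : j ∈ s)
    (hj : j ∉ negIndices a s F) : polarize a F j = a j := by
  classical
  simp only [negIndices, Finset.mem_filter, not_and] at hj
  simp only [polarize]
  rw [if_neg (hj hjs)]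

lemma negIndices_erase (a : ι → Γ) (s : Finset ι) (F : Set V) (j : ι) :
    negIndices a (s.erase j) F = (negIndices a s F).erase j := by
  ext i
  simp [negIndices, and_assoc]

lemma facePartition_sub {a : ι → Γ} {s : Finset ι} {F : Set V} (h : NoRelation (polarize a F) s)
    {j : ι} (hj : j ∈ s) (γ : Γ) :
    facePartition a s F γ - facePartition a s F (γ - a j) = facePartition a (s.erase j) F γ := by
  unfold facePartition
  rw [negIndices_erase]
  by_cases hN : j ∈ negIndices a s F
  · have hp := polarize_of_mem hN
    have hc := Finset.card_erase_add_one hN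
    have hsum := Finset.add_sum_erase _ (fun i => a i) hN
    have key := partitionFunction_sub h hj (γ + ∑ i ∈ (negIndices a s F).erase j, a i)
    rw [hp] at key
    rw [← key, ← hsum, ← hc, pow_succ]
    have e1 : γ - a j + (a j + ∑ i ∈ (negIndices a s F).erase j, a i) =
      γ + ∑ i ∈ (negIndices a s F).erase j, a i := by abel
    have e2 : γ + (a j + ∑ i ∈ (negIndices a s F).erase j, a i) =
      γ + ∑ i ∈ (negIndices a s F).erase j, a i - -a j := by abel
    rw [e1, e2]
    ring
  · have hp := polarize_of_notMem hj hN
    have key := partitionFunction_sub h hj (γ + ∑ i ∈ negIndices a s F, a i)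
    rw [hp] at key
    rw [Finset.erase_eq_of_notMem hN, ← key]
    have e1 : γ - a j + ∑ i ∈ negIndices a s F, a i = γ + ∑ i ∈ negIndices a s F, a i - a j := by
      abel
    rw [e1]
    ring

lemma convolution_facePartition_empty (a : ι → Γ) (F : Set V) (g : Γ → ℤ) :
    convolution (facePartition a ∅ F) g = g := by
  funext γ
  unfold convolution
  rw [finsum_eq_single _ 0]
  · simp [facePartition, negIndices, partitionFunction_empty_zero]
  · intro μ hμ
    simp [facePartition, negIndices, partitionFunction_empty_of_ne _ hμ]

lemma exists_of_facePartition_ne_zero {a : ι → Γ} {s : Finset ι} {F : Set V} {γ : Γ}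
    (h : facePartition a s F γ ≠ 0) :
    ∃ k : ι → ℕ, γ + ∑ i ∈ negIndices a s F, a i = ∑ i ∈ s, k i • polarize a F i :=
  exists_of_partitionFunction_ne_zero (right_ne_zero_of_mul h)

/-! ### Convolution -/

lemma ConvolutionDefined.support_finite {f g : Γ → ℤ} (h : ConvolutionDefined f g) (γ : Γ) :
    (Function.support fun μ => f μ * g (γ - μ)).Finite := by
  refine (h γ).subset fun μ hμ => ?_
  exact mul_ne_zero_iff.1 hμ

lemma convolution_sub_right {f g : Γ → ℤ} (h : ConvolutionDefined f g) (v γ : Γ) :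
    convolution f g γ - convolution f g (γ - v) =
      convolution f (fun x => g x - g (x - v)) γ := by
  unfold convolution
  rw [← finsum_sub_distrib (h.support_finite γ) (h.support_finite (γ - v))]
  refine finsum_congr fun μ => ?_
  rw [mul_sub, sub_right_comm γ v μ]

lemma convolution_sub_left {f g : Γ → ℤ} (h : ConvolutionDefined f g) (v γ : Γ) :
    convolution f g γ - convolution f g (γ - v) =
      convolution (fun x => f x - f (x - v)) g γ := by
  unfold convolution
  have e : ∑ᶠ μ : Γ, f μ * g (γ - v - μ) = ∑ᶠ μ : Γ, f (μ - v) * g (γ - μ) := by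
    rw [← finsum_comp_equiv (Equiv.subRight v)]
    refine finsum_congr fun μ => ?_
    simp only [Equiv.subRight_apply]
    congr 2
    abel
  have hfin : (Function.support fun μ => f (μ - v) * g (γ - μ)).Finite := by
    refine ((h.support_finite (γ - v)).image (· + v)).subset fun μ hμ => ⟨μ - v, ?_, by simp⟩
    have : γ - v - (μ - v) = γ - μ := by abel
    simpa [this] using hμ
  rw [e, ← finsum_sub_distrib (h.support_finite γ) hfin]
  refine finsum_congr fun μ => ?_
  rw [sub_mul]

lemma convolution_zero_right (f : Γ → ℤ) : convolution f 0 = 0 := by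
  funext γ
  simp [convolution]

end

section

variable {V : Type*} [NormedAddCommGroup V] [InnerProductSpace ℝ V]
  {Γ : Submodule ℤ V} {ι : Type*}

/-! ### Spans of sublists -/

open Classical in
/-- The indices in `s` of the vectors that lie in `r`. -/
noncomputable def restrictIn (a : ι → Γ) (s : Finset ι) (r : Submodule ℝ V) : Finset ι :=
  s.filter fun i => (a i : V) ∈ r

open Classical in
/-- The indices in `s` of the vectors that do not lie in `r`. -/
noncomputable def restrictOut (a : ι → Γ) (s : Finset ι) (r : Submodule ℝ V) : Finset ι :=
  s.filter fun i => (a i : V) ∉ r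

open Classical in
/-- The subspaces spanned by sublists of `s`. -/
noncomputable def flats (a : ι → Γ) (s : Finset ι) : Finset (Submodule ℝ V) :=
  s.powerset.image (spanOf a)

open Classical in
/-- The subspaces spanned by sublists of `s`, except the span of `s`. -/
noncomputable def properFlats (a : ι → Γ) (s : Finset ι) : Finset (Submodule ℝ V) :=
  (flats a s).filter fun r => r ≠ spanOf a s

lemma mem_restrictIn {a : ι → Γ} {s : Finset ι} {r : Submodule ℝ V} {i : ι} :
    i ∈ restrictIn a s r ↔ i ∈ s ∧ (a i : V) ∈ r := by
  simp [restrictIn]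

lemma mem_restrictOut {a : ι → Γ} {s : Finset ι} {r : Submodule ℝ V} {i : ι} :
    i ∈ restrictOut a s r ↔ i ∈ s ∧ (a i : V) ∉ r := by
  simp [restrictOut]

lemma mem_flats {a : ι → Γ} {s : Finset ι} {r : Submodule ℝ V} :
    r ∈ flats a s ↔ ∃ t ⊆ s, spanOf a t = r := by
  simp [flats]

lemma mem_properFlats {a : ι → Γ} {s : Finset ι} {r : Submodule ℝ V} :
    r ∈ properFlats a s ↔ r ∈ flats a s ∧ r ≠ spanOf a s := by
  simp [properFlats]

lemma spanOf_mem_flats (a : ι → Γ) (s : Finset ι) : spanOf a s ∈ flats a s :=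
  mem_flats.2 ⟨s, subset_rfl, rfl⟩

lemma mem_spanOf (a : ι → Γ) {s : Finset ι} {i : ι} (hi : i ∈ s) : (a i : V) ∈ spanOf a s :=
  Submodule.subset_span ⟨i, hi, rfl⟩

lemma spanOf_le {a : ι → Γ} {s : Finset ι} {r : Submodule ℝ V} :
    spanOf a s ≤ r ↔ ∀ i ∈ s, (a i : V) ∈ r := by
  simp [spanOf, Submodule.span_le, Set.subset_def]

lemma spanOf_mono (a : ι → Γ) {s t : Finset ι} (h : s ⊆ t) : spanOf a s ≤ spanOf a t :=
  spanOf_le.2 fun _ hi => mem_spanOf a (h hi)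

lemma le_of_mem_flats {a : ι → Γ} {s : Finset ι} {r : Submodule ℝ V} (h : r ∈ flats a s) :
    r ≤ spanOf a s := by
  obtain ⟨t, ht, rfl⟩ := mem_flats.1 h
  exact spanOf_mono a ht

lemma restrictIn_subset (a : ι → Γ) (s : Finset ι) (r : Submodule ℝ V) : restrictIn a s r ⊆ s :=
  fun _ hi => (mem_restrictIn.1 hi).1

lemma restrictOut_subset (a : ι → Γ) (s : Finset ι) (r : Submodule ℝ V) : restrictOut a s r ⊆ s :=
  fun _ hi => (mem_restrictOut.1 hi).1

lemma spanOf_restrictIn_le (a : ι → Γ) (s : Finset ι) (r : Submodule ℝ V) :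
    spanOf a (restrictIn a s r) ≤ r :=
  spanOf_le.2 fun _ hi => (mem_restrictIn.1 hi).2

lemma spanOf_restrictIn {a : ι → Γ} {s : Finset ι} {r : Submodule ℝ V} :
    r ∈ flats a s ↔ spanOf a (restrictIn a s r) = r := by
  constructor
  · intro h
    obtain ⟨t, ht, rfl⟩ := mem_flats.1 h
    refine le_antisymm (spanOf_restrictIn_le _ _ _) (spanOf_mono a fun i hi => ?_)
    exact mem_restrictIn.2 ⟨ht hi, mem_spanOf a hi⟩
  · intro h
    exact mem_flats.2 ⟨_, restrictIn_subset a s r, h⟩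

lemma exists_notMem_of_mem_properFlats {a : ι → Γ} {s : Finset ι} {r : Submodule ℝ V}
    (h : r ∈ properFlats a s) : ∃ i ∈ s, (a i : V) ∉ r := by
  obtain ⟨h1, h2⟩ := mem_properFlats.1 h
  by_contra! hc
  exact h2 (le_antisymm (le_of_mem_flats h1) (spanOf_le.2 hc))

lemma card_restrictIn_lt {a : ι → Γ} {s : Finset ι} {r : Submodule ℝ V}
    (h : r ∈ properFlats a s) : (restrictIn a s r).card < s.card := by
  obtain ⟨i, hi, hir⟩ := exists_notMem_of_mem_properFlats h
  refine Finset.card_lt_card ⟨restrictIn_subset a s r, fun hs => ?_⟩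
  exact hir (mem_restrictIn.1 (hs hi)).2

lemma sum_smul_mem_spanOf (a : ι → Γ) {s t : Finset ι} (h : t ⊆ s) (c : ι → ℝ) :
    ∑ i ∈ t, c i • (a i : V) ∈ spanOf a s :=
  Submodule.sum_mem _ fun _ hi => Submodule.smul_mem _ _ (mem_spanOf a (h hi))

/-! ### The quasi-polynomial pieces, defined by recursion -/

/-- The function on `Γ` that is what remains of the partition function of `s` when the
contributions of all the proper rational subspaces are removed. -/
noncomputable def quasiPart (a : ι → Γ) (F : Submodule ℝ V → Set V) (s : Finset ι) : Γ → ℤ :=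
  fun γ => partitionFunction a s γ - ∑ r ∈ (properFlats a s).attach,
    convolution (facePartition a (restrictOut a s r) (F r)) (quasiPart a F (restrictIn a s r)) γ
termination_by s.card
decreasing_by exact card_restrictIn_lt r.2

/-- The contribution of the subspace `r` to the partition function of `s`. -/
noncomputable def flatTerm (a : ι → Γ) (F : Submodule ℝ V → Set V) (s : Finset ι)
    (r : Submodule ℝ V) : Γ → ℤ :=
  convolution (facePartition a (restrictOut a s r) (F r)) (quasiPart a F (restrictIn a s r))

variable [Fintype ι] [DecidableEq ι]

lemma mem_rationalSubspaces {a : ι → Γ} {r : Submodule ℝ V} :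
    r ∈ rationalSubspaces a ↔ ∃ t, spanOf a t = r := by
  simp [rationalSubspaces]

lemma flats_univ (a : ι → Γ) : flats a Finset.univ = rationalSubspaces a := by
  ext r
  simp [mem_flats, mem_rationalSubspaces]

lemma rational_of_mem_flats {a : ι → Γ} {s : Finset ι} {r : Submodule ℝ V} (h : r ∈ flats a s) :
    r ∈ rationalSubspaces a := by
  obtain ⟨t, _, ht⟩ := mem_flats.1 h
  exact mem_rationalSubspaces.2 ⟨t, ht⟩

lemma mem_spanOf_of_partitionFunction_ne_zero {a : ι → Γ} {s : Finset ι} {γ : Γ}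
    (h : partitionFunction a s γ ≠ 0) : (γ : V) ∈ spanOf a s := by
  obtain ⟨k, rfl⟩ := exists_of_partitionFunction_ne_zero h
  push_cast
  exact Submodule.sum_mem _ fun i hi => Submodule.smul_of_tower_mem _ _ (mem_spanOf a hi)

lemma coe_polarize_mem {a : ι → Γ} {s : Finset ι} (F : Set V) {i : ι} (hi : i ∈ s) :
    (polarize a F i : V) ∈ spanOf a s := by
  unfold polarize
  split_ifs
  · simpa using mem_spanOf a hi
  · exact mem_spanOf a hi

lemma negIndices_subset (a : ι → Γ) (s : Finset ι) (F : Set V) : negIndices a s F ⊆ s := by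
  classical
  exact Finset.filter_subset _ _

lemma mem_spanOf_of_facePartition_ne_zero {a : ι → Γ} {s : Finset ι} {F : Set V} {γ : Γ}
    (h : facePartition a s F γ ≠ 0) : (γ : V) ∈ spanOf a s := by
  obtain ⟨k, hk⟩ := exists_of_facePartition_ne_zero h
  have hk' : γ = ∑ i ∈ s, k i • polarize a F i - ∑ i ∈ negIndices a s F, a i := by
    rw [← hk, add_sub_cancel_right]
  rw [hk']
  push_cast
  refine Submodule.sub_mem _ (Submodule.sum_mem _ fun i hi => ?_)
    (Submodule.sum_mem _ fun i hi => mem_spanOf a (negIndices_subset a s F hi))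
  exact Submodule.smul_of_tower_mem _ _ (coe_polarize_mem F hi)

lemma quasiPart_eq (a : ι → Γ) (F : Submodule ℝ V → Set V) (s : Finset ι) (γ : Γ) :
    quasiPart a F s γ = partitionFunction a s γ - ∑ r ∈ properFlats a s, flatTerm a F s r γ := by
  rw [quasiPart, ← Finset.sum_attach (properFlats a s)]
  rfl

lemma exists_of_convolution_ne_zero {f g : Γ → ℤ} {γ : Γ} (h : convolution f g γ ≠ 0) :
    ∃ μ, f μ ≠ 0 ∧ g (γ - μ) ≠ 0 := by
  by_contra! hc
  refine h (finsum_eq_zero_of_forall_eq_zero fun μ => ?_)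
  by_cases hf : f μ = 0
  · simp [hf]
  · simp [hc μ hf]

lemma restrictOut_spanOf (a : ι → Γ) (s : Finset ι) : restrictOut a s (spanOf a s) = ∅ := by
  ext i
  simp only [mem_restrictOut, Finset.notMem_empty, iff_false, not_and, not_not]
  exact fun hi => mem_spanOf a hi

lemma restrictIn_spanOf (a : ι → Γ) (s : Finset ι) : restrictIn a s (spanOf a s) = s := by
  ext i
  simp only [mem_restrictIn, and_iff_left_iff_imp]
  exact fun hi => mem_spanOf a hi

lemma flatTerm_spanOf (a : ι → Γ) (F : Submodule ℝ V → Set V) (s : Finset ι) :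
    flatTerm a F s (spanOf a s) = quasiPart a F s := by
  rw [flatTerm, restrictOut_spanOf, restrictIn_spanOf, convolution_facePartition_empty]

lemma partitionFunction_eq_sum_flatTerm (a : ι → Γ) (F : Submodule ℝ V → Set V) (s : Finset ι)
    (γ : Γ) : partitionFunction a s γ = ∑ r ∈ flats a s, flatTerm a F s r γ := by
  classical
  have h : properFlats a s = (flats a s).erase (spanOf a s) := by
    ext r
    simp [mem_properFlats, and_comm]
  rw [← Finset.add_sum_erase _ _ (spanOf_mem_flats a s), ← h, flatTerm_spanOf, quasiPart_eq]
  ring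

lemma quasiPart_eq_zero {a : ι → Γ} (F : Submodule ℝ V → Set V) {s : Finset ι} {γ : Γ}
    (h : (γ : V) ∉ spanOf a s) : quasiPart a F s γ = 0 := by
  induction hn : s.card using Nat.strong_induction_on generalizing s γ with
  | _ n ih =>
  rw [quasiPart_eq, Finset.sum_eq_zero, sub_zero]
  · by_contra hc
    exact h (mem_spanOf_of_partitionFunction_ne_zero hc)
  · intro r hr
    by_contra hc
    obtain ⟨μ, h1, h2⟩ := exists_of_convolution_ne_zero hc
    have h1' := spanOf_mono a (restrictOut_subset a s r) (mem_spanOf_of_facePartition_ne_zero h1)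
    have h2' : ((γ - μ : Γ) : V) ∈ spanOf a (restrictIn a s r) := by
      by_contra h3
      exact h2 (ih _ (hn ▸ card_restrictIn_lt hr) h3 rfl)
    have h3 := Submodule.add_mem _ h1' (spanOf_mono a (restrictIn_subset a s r) h2')
    push_cast at h3
    rw [add_sub_cancel] at h3
    exact h h3

section

variable [FiniteDimensional ℝ V]

/-- For every rational subspace `r`, the polarization of the vectors outside `r` according to the
face `F r` makes them negative on the projection of `β` to `rᗮ`. -/
def OpposesProjections (a : ι → Γ) (β : V) (F : Submodule ℝ V → Set V) : Prop :=
  ∀ r ∈ rationalSubspaces a, ∀ i, (a i : V) ∉ r →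
    inner ℝ (rᗮ.starProjection β) (polarize a (F r) i : V) < 0

variable {a : ι → Γ} {β : V} {F : Submodule ℝ V → Set V}

lemma OpposesProjections.noRelation_real (hF : OpposesProjections a β F) {r : Submodule ℝ V}
    (hr : r ∈ rationalSubspaces a) {s : Finset ι} (hs : ∀ i ∈ s, (a i : V) ∉ r) :
    NoRelation (fun i => inner ℝ (rᗮ.starProjection β) (polarize a (F r) i : V)) s := by
  intro k hk h0
  have h1 := (Finset.sum_eq_zero_iff_of_nonpos (s := s) fun i hi => by
    have := hF r hr i (hs i hi)
    simp only [nsmul_eq_mul]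
    exact mul_nonpos_of_nonneg_of_nonpos (Nat.cast_nonneg _) this.le).1 h0
  funext i
  by_cases hi : i ∈ s
  · have h2 := h1 i hi
    rw [nsmul_eq_mul, mul_eq_zero] at h2
    exact_mod_cast h2.resolve_right (hF r hr i (hs i hi)).ne
  · exact hk i hi

lemma OpposesProjections.noRelation (hF : OpposesProjections a β F) {r : Submodule ℝ V}
    (hr : r ∈ rationalSubspaces a) {s : Finset ι} (hs : ∀ i ∈ s, (a i : V) ∉ r) :
    NoRelation (polarize a (F r)) s := by
  intro k hk h0
  refine hF.noRelation_real hr hs k hk ?_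
  have := congrArg (fun x : Γ => inner ℝ (rᗮ.starProjection β) (x : V)) h0
  simpa [inner_sum, inner_smul_right, ← Nat.cast_smul_eq_nsmul ℝ] using this

lemma OpposesProjections.convolutionDefined (hF : OpposesProjections a β F) {r : Submodule ℝ V}
    (hr : r ∈ rationalSubspaces a) {s : Finset ι} (hs : ∀ i ∈ s, (a i : V) ∉ r) {g : Γ → ℤ}
    (hg : ∀ γ : Γ, (γ : V) ∉ r → g γ = 0) :
    ConvolutionDefined (facePartition a s (F r)) g := by
  intro γ
  set u := rᗮ.starProjection β with hu
  set σ := ∑ i ∈ negIndices a s (F r), a i with hσ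
  have hur : ∀ x ∈ r, inner ℝ u x = 0 := fun x hx =>
    (Submodule.mem_orthogonal' r u).1 (Submodule.starProjection_apply_mem _ _) x hx
  refine (((hF.noRelation_real hr hs).finite (inner ℝ u ((γ + σ : Γ) : V))).image
    fun k => ∑ i ∈ s, k i • polarize a (F r) i - σ).subset ?_
  rintro μ ⟨h1, h2⟩
  obtain ⟨k, hk⟩ := exists_of_facePartition_ne_zero h1
  have h3 : ((γ - μ : Γ) : V) ∈ r := by
    by_contra h
    exact h2 (hg _ h)
  have h4 := hur _ h3
  push_cast at h4
  rw [inner_sub_right] at h4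
  classical
  refine ⟨fun i => if i ∈ s then k i else 0, ⟨fun i hi => by simp [hi], ?_⟩, ?_⟩
  · have := congrArg (fun x : Γ => inner ℝ u (x : V)) hk
    simp only [Submodule.coe_add, inner_add_right] at this ⊢
    rw [sub_eq_zero.1 h4, hσ, this]
    simp only [AddSubmonoidClass.coe_finsetSum, inner_sum]
    refine Finset.sum_congr rfl fun i hi => ?_
    rw [if_pos hi, ← hu, Submodule.coe_smul_of_tower, ← Nat.cast_smul_eq_nsmul ℝ (k i) (_ : V),
      inner_smul_right, nsmul_eq_mul]
  · simp only
    rw [Finset.sum_congr rfl (g := fun i => k i • polarize a (F r) i) fun i hi => by simp [hi],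
      ← hk, add_sub_cancel_right]

lemma OpposesProjections.convolutionDefined_flat (hF : OpposesProjections a β F)
    {s : Finset ι} {r : Submodule ℝ V} (hr : r ∈ flats a s) :
    ConvolutionDefined (facePartition a (restrictOut a s r) (F r))
      (quasiPart a F (restrictIn a s r)) :=
  hF.convolutionDefined (rational_of_mem_flats hr) (fun _ hi => (mem_restrictOut.1 hi).2)
    fun _ h => quasiPart_eq_zero F fun h' => h (spanOf_restrictIn_le a s r h')

end

end

section

variable {V : Type*} [NormedAddCommGroup V] [InnerProductSpace ℝ V]
  {Γ : Submodule ℤ V} {ι : Type*}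

variable [Fintype ι] [DecidableEq ι] [FiniteDimensional ℝ V]

/-! ### Difference equations -/

lemma restrictOut_erase (a : ι → Γ) (s : Finset ι) (r : Submodule ℝ V) (j : ι) :
    restrictOut a (s.erase j) r = (restrictOut a s r).erase j := by
  ext i
  simp [mem_restrictOut, and_assoc]

lemma restrictIn_erase (a : ι → Γ) (s : Finset ι) (r : Submodule ℝ V) (j : ι) :
    restrictIn a (s.erase j) r = (restrictIn a s r).erase j := by
  ext i
  simp [mem_restrictIn, and_assoc]

section

variable {a : ι → Γ} {β : V} {F : Submodule ℝ V → Set V}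

open Classical in
theorem quasiPart_sub (ha : NoRelation a Finset.univ) (hF : OpposesProjections a β F)
    {s : Finset ι} {j : ι} (hj : j ∈ s) (γ : Γ) :
    quasiPart a F s γ - quasiPart a F s (γ - a j) =
      if spanOf a (s.erase j) = spanOf a s then quasiPart a F (s.erase j) γ else 0 := by
  induction hn : s.card using Nat.strong_induction_on generalizing s γ with
  | _ n ih =>
  have hterm : ∀ r ∈ properFlats a s, flatTerm a F s r γ - flatTerm a F s r (γ - a j) =
      if r ∈ flats a (s.erase j) then flatTerm a F (s.erase j) r γ else 0 := by
    intro r hr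
    have hrf := (mem_properFlats.1 hr).1
    have hdef := hF.convolutionDefined_flat hrf
    have hspan := spanOf_restrictIn.1 hrf
    unfold flatTerm
    by_cases hjr : (a j : V) ∈ r
    · have hj' : j ∈ restrictIn a s r := mem_restrictIn.2 ⟨hj, hjr⟩
      have ho : restrictOut a (s.erase j) r = restrictOut a s r := by
        rw [restrictOut_erase, Finset.erase_eq_of_notMem]
        exact fun h => (mem_restrictOut.1 h).2 hjr
      rw [convolution_sub_right hdef, ho, restrictIn_erase]
      have hq := fun x => ih _ (hn ▸ card_restrictIn_lt hr) hj' x rfl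
      simp only [hq]
      have hiff : r ∈ flats a (s.erase j) ↔ spanOf a ((restrictIn a s r).erase j) = r := by
        rw [spanOf_restrictIn, restrictIn_erase]
      simp only [hspan]
      by_cases h : spanOf a ((restrictIn a s r).erase j) = r
      · rw [if_pos (hiff.2 h)]
        simp only [if_pos h]
      · rw [if_neg fun h' => h (hiff.1 h')]
        simp only [if_neg h]
        exact congrFun (convolution_zero_right _) γ
    · have hi : restrictIn a (s.erase j) r = restrictIn a s r := by
        rw [restrictIn_erase, Finset.erase_eq_of_notMem]
        exact fun h => hjr (mem_restrictIn.1 h).2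
      have hj' : j ∈ restrictOut a s r := mem_restrictOut.2 ⟨hj, hjr⟩
      have hnr := hF.noRelation (rational_of_mem_flats hrf) (s := restrictOut a s r)
        fun _ hi => (mem_restrictOut.1 hi).2
      rw [if_pos (spanOf_restrictIn.2 (by rw [hi, hspan])), convolution_sub_left hdef]
      simp only [facePartition_sub hnr hj']
      rw [hi, restrictOut_erase]
  have hP := partitionFunction_sub (ha.mono (Finset.subset_univ s)) hj γ
  have hsum : quasiPart a F s γ - quasiPart a F s (γ - a j) =
      partitionFunction a (s.erase j) γ - ∑ r ∈ properFlats a s,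
        if r ∈ flats a (s.erase j) then flatTerm a F (s.erase j) r γ else 0 := by
    rw [quasiPart_eq, quasiPart_eq, ← hP, ← Finset.sum_congr rfl hterm, Finset.sum_sub_distrib]
    ring
  rw [hsum, ← Finset.sum_filter]
  have hmono : ∀ r, r ∈ flats a (s.erase j) → r ∈ flats a s := by
    intro r hr
    obtain ⟨t, ht, rfl⟩ := mem_flats.1 hr
    exact mem_flats.2 ⟨t, ht.trans (Finset.erase_subset _ _), rfl⟩
  split_ifs with h
  · have : (properFlats a s).filter (fun r => r ∈ flats a (s.erase j)) =
        properFlats a (s.erase j) := by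
      ext r
      simp only [Finset.mem_filter, mem_properFlats, h]
      have := hmono r
      tauto
    rw [this, ← quasiPart_eq]
  · have : (properFlats a s).filter (fun r => r ∈ flats a (s.erase j)) =
        flats a (s.erase j) := by
      ext r
      simp only [Finset.mem_filter, mem_properFlats]
      refine ⟨fun h => h.2, fun hr => ⟨⟨hmono r hr, ?_⟩, hr⟩⟩
      rintro rfl
      exact h (le_antisymm (spanOf_mono a (Finset.erase_subset _ _)) (le_of_mem_flats hr))
    rw [this, ← partitionFunction_eq_sum_flatTerm, sub_self]

lemma OpposesProjections.inner_pos (hF : OpposesProjections a β F) {r : Submodule ℝ V}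
    (hr : r ∈ rationalSubspaces a) {s : Finset ι} {i : ι} (hi : i ∈ negIndices a s (F r))
    (hir : (a i : V) ∉ r) : 0 < inner ℝ (rᗮ.starProjection β) (a i : V) := by
  have h := hF r hr i hir
  rw [polarize_of_mem hi, Submodule.coe_neg, inner_neg_right] at h
  linarith

lemma OpposesProjections.inner_neg (hF : OpposesProjections a β F) {r : Submodule ℝ V}
    (hr : r ∈ rationalSubspaces a) {s : Finset ι} {i : ι} (his : i ∈ s)
    (hi : i ∉ negIndices a s (F r)) (hir : (a i : V) ∉ r) :
    inner ℝ (rᗮ.starProjection β) (a i : V) < 0 := by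
  have h := hF r hr i hir
  rwa [polarize_of_notMem his hi] at h

lemma OpposesProjections.inner_ne_zero (hF : OpposesProjections a β F) {r : Submodule ℝ V}
    (hr : r ∈ rationalSubspaces a) {i : ι} (hir : (a i : V) ∉ r) :
    inner ℝ (rᗮ.starProjection β) (a i : V) ≠ 0 := by
  by_cases hi : i ∈ negIndices a Finset.univ (F r)
  · exact (hF.inner_pos hr hi hir).ne'
  · exact (hF.inner_neg hr (Finset.mem_univ i) hi hir).ne

lemma inner_orthogonal_starProjection_eq_zero (r : Submodule ℝ V) (β : V) {x : V} (hx : x ∈ r) :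
    inner ℝ (rᗮ.starProjection β) x = 0 :=
  (Submodule.mem_orthogonal' r _).1 (Submodule.starProjection_apply_mem _ _) x hx

lemma OpposesProjections.inner_starProjection_pos (hF : OpposesProjections a β F)
    {s : Finset ι} {r : Submodule ℝ V} (hr : r ∈ properFlats a s) :
    0 < inner ℝ (rᗮ.starProjection β) ((spanOf a s).starProjection β) := by
  obtain ⟨hrf, -⟩ := mem_properFlats.1 hr
  obtain ⟨i, his, hir⟩ := exists_notMem_of_mem_properFlats hr
  have hle := le_of_mem_flats hrf
  have hne := hF.inner_ne_zero (rational_of_mem_flats hrf) hir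
  set p := (spanOf a s).starProjection β with hp
  set p' := r.starProjection β with hp'
  set u := rᗮ.starProjection β with hu
  have hd : ∀ x ∈ spanOf a s, inner ℝ (β - p) x = 0 := fun x hx => by
    have := inner_orthogonal_starProjection_eq_zero (spanOf a s) β hx
    rwa [Submodule.starProjection_orthogonal_val] at this
  have hu' : u = β - p' := Submodule.starProjection_orthogonal_val _
  have hux : ∀ x ∈ spanOf a s, inner ℝ u x = inner ℝ (p - p') x := fun x hx => by
    have := hd x hx
    rw [hu']
    rw [inner_sub_left] at this ⊢
    rw [inner_sub_left]
    linarith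
  have hpm : p ∈ spanOf a s := Submodule.starProjection_apply_mem _ _
  have hpm' : p' ∈ r := Submodule.starProjection_apply_mem _ _
  have h1 : inner ℝ u p = inner ℝ (p - p') (p - p') := by
    rw [← hux _ (Submodule.sub_mem _ hpm (hle hpm')), inner_sub_right,
      inner_orthogonal_starProjection_eq_zero r β hpm', sub_zero]
  rw [h1]
  refine lt_of_le_of_ne real_inner_self_nonneg fun h0 => hne ?_
  rw [hux _ (mem_spanOf a his), inner_self_eq_zero.1 h0.symm, inner_zero_left]

lemma flatTerm_eq_zero (hF : OpposesProjections a β F) {s : Finset ι} {r : Submodule ℝ V}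
    (hr : r ∈ properFlats a s) {c : ι → ℝ} (hc : ∀ i, 0 ≤ c i ∧ c i ≤ 1) {γ : Γ}
    (hγ : (γ : V) = (spanOf a s).starProjection β - ∑ i ∈ s, c i • (a i : V)) :
    flatTerm a F s r γ = 0 := by
  by_contra hne
  obtain ⟨μ, h1, h2⟩ := exists_of_convolution_ne_zero hne
  have hrf := (mem_properFlats.1 hr).1
  have hrat := rational_of_mem_flats hrf
  have hpos := hF.inner_starProjection_pos hr
  obtain ⟨k, hk⟩ := exists_of_facePartition_ne_zero h1
  have h3 : ((γ - μ : Γ) : V) ∈ r := by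
    by_contra h
    exact h2 (quasiPart_eq_zero F fun h' => h (spanOf_restrictIn_le a s r h'))
  have h4 := inner_orthogonal_starProjection_eq_zero r β h3
  set u := rᗮ.starProjection β with hu
  set N := negIndices a (restrictOut a s r) (F r) with hN
  have hNs : N ⊆ restrictOut a s r := negIndices_subset _ _ _
  have hout : ∀ i ∈ restrictOut a s r, (a i : V) ∉ r := fun i hi => (mem_restrictOut.1 hi).2
  have hμ : inner ℝ u (μ : V) ≤ - ∑ i ∈ N, inner ℝ u (a i : V) := by
    have h5 := congrArg (fun x : Γ => inner ℝ u (x : V)) hk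
    simp only [Submodule.coe_add, inner_add_right, AddSubmonoidClass.coe_finsetSum, inner_sum]
      at h5
    have h6 : ∑ i ∈ restrictOut a s r, inner ℝ u ((k i • polarize a (F r) i : Γ) : V) ≤ 0 := by
      refine Finset.sum_nonpos fun i hi => ?_
      rw [Submodule.coe_smul_of_tower, ← Nat.cast_smul_eq_nsmul ℝ (k i) (_ : V),
        inner_smul_right]
      exact mul_nonpos_of_nonneg_of_nonpos (Nat.cast_nonneg _) (hF r hrat i (hout i hi)).le
    linarith
  have hsum : ∑ i ∈ s, c i * inner ℝ u (a i : V) ≤ ∑ i ∈ N, inner ℝ u (a i : V) := by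
    rw [← Finset.sum_sdiff (hNs.trans (restrictOut_subset a s r))]
    have h5 : ∑ i ∈ s \ N, c i * inner ℝ u (a i : V) ≤ 0 := by
      refine Finset.sum_nonpos fun i hi => ?_
      obtain ⟨his, hiN⟩ := Finset.mem_sdiff.1 hi
      by_cases hir : (a i : V) ∈ r
      · rw [inner_orthogonal_starProjection_eq_zero r β hir, mul_zero]
      · exact mul_nonpos_of_nonneg_of_nonpos (hc i).1
          (hF.inner_neg hrat (mem_restrictOut.2 ⟨his, hir⟩) hiN hir).le
    have h6 : ∑ i ∈ N, c i * inner ℝ u (a i : V) ≤ ∑ i ∈ N, inner ℝ u (a i : V) :=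
      Finset.sum_le_sum fun i hi =>
        mul_le_of_le_one_left (hF.inner_pos hrat hi (hout i (hNs hi))).le (hc i).2
    linarith
  have hγu : inner ℝ u (γ : V) = inner ℝ u ((spanOf a s).starProjection β) -
      ∑ i ∈ s, c i * inner ℝ u (a i : V) := by
    rw [hγ, inner_sub_right, inner_sum]
    simp only [inner_smul_right]
  rw [Submodule.coe_sub, inner_sub_right] at h4
  linarith

theorem quasiPart_eq_partitionFunction (hF : OpposesProjections a β F) {s : Finset ι} {γ : Γ}
    (hγ : (γ : V) ∈ {(spanOf a s).starProjection β} - zonotope a s) :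
    quasiPart a F s γ = partitionFunction a s γ := by
  obtain ⟨_, rfl, _, ⟨c, hc, rfl⟩, h⟩ := hγ
  rw [quasiPart_eq, Finset.sum_eq_zero fun r hr => flatTerm_eq_zero hF hr hc h.symm, sub_zero]

end

end

section

variable {V : Type*} [NormedAddCommGroup V] [InnerProductSpace ℝ V]
  {Γ : Submodule ℤ V} {ι : Type*}

/-! ### Polynomial functions -/

/-- `f` is a polynomial in linear functionals. -/
def IsPolynomialFunction (f : V → ℝ) : Prop :=
  ∃ p : MvPolynomial (Module.Dual ℝ V) ℝ, ∀ x, f x = MvPolynomial.eval (fun φ => φ x) p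

namespace IsPolynomialFunction

lemma const (c : ℝ) : IsPolynomialFunction fun _ : V => c :=
  ⟨MvPolynomial.C c, fun x => by simp⟩

lemma dual (φ : Module.Dual ℝ V) : IsPolynomialFunction fun x => φ x :=
  ⟨MvPolynomial.X φ, fun x => by simp⟩

lemma add {f g : V → ℝ} (hf : IsPolynomialFunction f) (hg : IsPolynomialFunction g) :
    IsPolynomialFunction fun x => f x + g x := by
  obtain ⟨p, hp⟩ := hf
  obtain ⟨q, hq⟩ := hg
  exact ⟨p + q, fun x => by simp [hp, hq]⟩

lemma mul {f g : V → ℝ} (hf : IsPolynomialFunction f) (hg : IsPolynomialFunction g) :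
    IsPolynomialFunction fun x => f x * g x := by
  obtain ⟨p, hp⟩ := hf
  obtain ⟨q, hq⟩ := hg
  exact ⟨p * q, fun x => by simp [hp, hq]⟩

lemma sub {f g : V → ℝ} (hf : IsPolynomialFunction f) (hg : IsPolynomialFunction g) :
    IsPolynomialFunction fun x => f x - g x := by
  obtain ⟨p, hp⟩ := hf
  obtain ⟨q, hq⟩ := hg
  exact ⟨p - q, fun x => by simp [hp, hq]⟩

lemma aeval {f : V → ℝ} (hf : IsPolynomialFunction f) (S : Polynomial ℝ) :
    IsPolynomialFunction fun x => S.eval (f x) := by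
  obtain ⟨p, hp⟩ := hf
  refine ⟨Polynomial.aeval p S, fun x => ?_⟩
  beta_reduce
  rw [hp, Polynomial.aeval_def, Polynomial.hom_eval₂, Polynomial.eval, MvPolynomial.algebraMap_eq]
  congr 1
  ext c
  simp

lemma comp_affine {f : V → ℝ} (hf : IsPolynomialFunction f) (φ : Module.Dual ℝ V) (k : ℝ) (v : V) :
    IsPolynomialFunction fun x => f (x - (φ x - k) • v) := by
  obtain ⟨p, hp⟩ := hf
  refine ⟨MvPolynomial.aeval (fun ψ : Module.Dual ℝ V => MvPolynomial.X ψ -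
    (MvPolynomial.X φ - MvPolynomial.C k) * MvPolynomial.C (ψ v)) p, fun x => ?_⟩
  beta_reduce
  rw [hp, MvPolynomial.aeval_def, MvPolynomial.eval_eval₂]
  simp only [MvPolynomial.eval, MvPolynomial.coe_eval₂Hom]
  congr 1
  · ext c
    simp
  · funext ψ
    simp

lemma comp_sub {f : V → ℝ} (hf : IsPolynomialFunction f) (v : V) :
    IsPolynomialFunction fun x => f (x - v) := by
  simpa using hf.comp_affine 0 (-1) v

end IsPolynomialFunction

lemma exists_polynomial_sub_eq_pow (k : ℕ) :
    ∃ S : Polynomial ℝ, ∀ t : ℝ, S.eval t - S.eval (t - 1) = t ^ k := by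
  set B := (Polynomial.bernoulli (k + 1)).map (algebraMap ℚ ℝ) with hB
  have h : ∀ x : ℝ, B.eval (1 + x) = B.eval x + (k + 1) * x ^ k := by
    intro x
    have := congrArg (fun p => (p.map (algebraMap ℚ ℝ)).eval x)
      (Polynomial.bernoulli_comp_one_add_X (k + 1))
    simpa [Polynomial.map_comp, hB] using this
  refine ⟨Polynomial.C ((k + 1 : ℝ)⁻¹) * B.comp (1 + Polynomial.X), fun t => ?_⟩
  have hk : (k + 1 : ℝ) ≠ 0 := by positivity
  simp only [Polynomial.eval_mul, Polynomial.eval_C, Polynomial.eval_comp, Polynomial.eval_add,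
    Polynomial.eval_one, Polynomial.eval_X]
  rw [h t, add_sub_cancel]
  field_simp
  ring

lemma IsPolynomialFunction.exists_sub_eq {D : V → ℝ} (hD : IsPolynomialFunction D)
    {φ : Module.Dual ℝ V} {v : V} (hv : φ v = 1) :
    ∃ G, IsPolynomialFunction G ∧ ∀ x, G x - G (x - v) = D x := by
  set M := Submodule.span ℝ {f : V → ℝ | ∃ (E : V → ℝ) (k : ℕ), IsPolynomialFunction E ∧
    (∀ x, E (x - v) = E x) ∧ f = fun x => E x * φ x ^ k} with hM
  have hmul : ∀ (ψ : Module.Dual ℝ V) (f : V → ℝ), f ∈ M → (fun x => f x * ψ x) ∈ M := by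
    intro ψ f hf
    induction hf using Submodule.span_induction with
    | mem f hf =>
      obtain ⟨E, k, hE, hEv, rfl⟩ := hf
      have h1 : (fun x => E x * (ψ x - ψ v * φ x) * φ x ^ k) ∈ M := by
        refine Submodule.subset_span ⟨fun x => E x * (ψ x - ψ v * φ x), k,
          hE.mul ((IsPolynomialFunction.dual ψ).sub ((IsPolynomialFunction.const _).mul (IsPolynomialFunction.dual φ))), fun x => ?_, rfl⟩
        simp only [hEv, map_sub, hv]
        ring
      have h2 : (fun x => E x * φ x ^ (k + 1)) ∈ M := Submodule.subset_span ⟨E, k + 1, hE, hEv, rfl⟩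
      convert M.add_mem h1 (M.smul_mem (ψ v) h2) using 1
      funext x
      simp only [Pi.add_apply, Pi.smul_apply, smul_eq_mul]
      ring
    | zero =>
      convert M.zero_mem using 1
      funext x
      simp
    | add f g _ _ hf hg =>
      convert M.add_mem hf hg using 1
      funext x
      simp [add_mul]
    | smul c f _ hf =>
      convert M.smul_mem c hf using 1
      funext x
      simp [mul_assoc]
  have hDM : D ∈ M := by
    obtain ⟨p, hp⟩ := hD
    rw [show D = fun x => MvPolynomial.eval (fun φ : Module.Dual ℝ V => φ x) p from funext hp]
    clear hp
    induction p using MvPolynomial.induction_on with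
    | C c => exact Submodule.subset_span ⟨fun _ => c, 0, IsPolynomialFunction.const c, fun _ => rfl, by simp⟩
    | add p q hp hq =>
      convert M.add_mem hp hq using 1
      funext x
      simp
    | mul_X p ψ hp =>
      convert hmul ψ _ hp using 1
      funext x
      simp
  clear hD
  induction hDM using Submodule.span_induction with
  | mem f hf =>
    obtain ⟨E, k, hE, hEv, rfl⟩ := hf
    obtain ⟨S, hS⟩ := exists_polynomial_sub_eq_pow k
    refine ⟨fun x => E x * S.eval (φ x), hE.mul ((IsPolynomialFunction.dual φ).aeval S), fun x => ?_⟩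
    simp only [hEv, map_sub, hv, ← mul_sub, hS]
  | zero => exact ⟨fun _ => 0, IsPolynomialFunction.const 0, fun x => by simp⟩
  | add f g _ _ hf hg =>
    obtain ⟨F, hF, hF'⟩ := hf
    obtain ⟨G, hG, hG'⟩ := hg
    refine ⟨_, hF.add hG, fun x => ?_⟩
    rw [Pi.add_apply, ← hF', ← hG']
    ring
  | smul c f _ hf =>
    obtain ⟨F, hF, hF'⟩ := hf
    refine ⟨_, (IsPolynomialFunction.const c).mul hF, fun x => ?_⟩
    rw [Pi.smul_apply, ← hF', smul_eq_mul]
    ring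

/-! ### Functions that are polynomial on a coset -/

/-- `g` coincides with a polynomial on the coset `c + L`. -/
def IsPolynomialOn (g : Γ → ℝ) (c : Γ) (L : AddSubgroup Γ) : Prop :=
  ∃ f : V → ℝ, IsPolynomialFunction f ∧ ∀ l ∈ L, g (c + l) = f ((c + l : Γ) : V)

namespace IsPolynomialOn

lemma mono {g : Γ → ℝ} {c : Γ} {L M : AddSubgroup Γ} (h : IsPolynomialOn g c L) (hM : M ≤ L) :
    IsPolynomialOn g c M := by
  obtain ⟨f, hf, hfg⟩ := h
  exact ⟨f, hf, fun l hl => hfg l (hM hl)⟩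

lemma bot (g : Γ → ℝ) (c : Γ) : IsPolynomialOn g c ⊥ :=
  ⟨fun _ => g c, IsPolynomialFunction.const _, fun l hl => by
    rw [AddSubgroup.mem_bot.1 hl, add_zero]⟩

lemma add {g h : Γ → ℝ} {c : Γ} {L : AddSubgroup Γ} (hg : IsPolynomialOn g c L)
    (hh : IsPolynomialOn h c L) : IsPolynomialOn (fun x => g x + h x) c L := by
  obtain ⟨p, hp, hpg⟩ := hg
  obtain ⟨q, hq, hqh⟩ := hh
  exact ⟨_, hp.add hq, fun l hl => by simp only [hpg l hl, hqh l hl]⟩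

lemma comp_sub {g : Γ → ℝ} {c v : Γ} {L : AddSubgroup Γ} (hg : IsPolynomialOn g (c - v) L) :
    IsPolynomialOn (fun x => g (x - v)) c L := by
  obtain ⟨p, hp, hpg⟩ := hg
  refine ⟨_, hp.comp_sub v, fun l hl => ?_⟩
  have := hpg l hl
  rw [sub_add_eq_add_sub] at this
  simpa using this

lemma sub_nsmul {g : Γ → ℝ} {v : Γ} {L R : AddSubgroup Γ} (hv : v ∈ R)
    (h : ∀ c ∈ R, IsPolynomialOn (fun x => g x - g (x - v)) c L) (n : ℕ) :
    ∀ c ∈ R, IsPolynomialOn (fun x => g x - g (x - n • v)) c L := by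
  induction n with
  | zero =>
    intro c _
    exact ⟨_, IsPolynomialFunction.const 0, fun l _ => by simp⟩
  | succ n ih =>
    intro c hc
    convert (h c hc).add (comp_sub (v := v) (ih (c - v) (R.sub_mem hc hv))) using 2 with x
    rw [succ_nsmul', ← sub_sub]
    ring

lemma sup_zmultiples {g : Γ → ℝ} {c v : Γ} {L : AddSubgroup Γ} {φ : Module.Dual ℝ V}
    (hv : φ (v : V) = 1) (hL : ∀ l ∈ L, φ (l : V) = 0) (hg : IsPolynomialOn g c L)
    (hd : IsPolynomialOn (fun x => g x - g (x - v)) c (L ⊔ AddSubgroup.zmultiples v)) :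
    IsPolynomialOn g c (L ⊔ AddSubgroup.zmultiples v) := by
  obtain ⟨D, hD, hDg⟩ := hd
  obtain ⟨G, hG, hGD⟩ := hD.exists_sub_eq hv
  obtain ⟨f, hf, hfg⟩ := hg
  refine ⟨_, hG.add ((hf.sub hG).comp_affine φ (φ (c : V)) v), fun l hl => ?_⟩
  obtain ⟨m, hm, _, ⟨n, rfl⟩, rfl⟩ := AddSubgroup.mem_sup.1 hl
  simp only
  have hstep : ∀ n : ℤ, g (c + (m + n • v)) - G ((c + (m + n • v) : Γ) : V) =
      g (c + (m + (n - 1) • v)) - G ((c + (m + (n - 1) • v) : Γ) : V) := by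
    intro n
    have h1 := hDg (m + n • v) (AddSubgroup.mem_sup.2 ⟨m, hm, _, ⟨n, rfl⟩, rfl⟩)
    have h2 : c + (m + n • v) - v = c + (m + (n - 1) • v) := by
      rw [sub_smul, one_smul]
      abel
    beta_reduce at h1
    rw [← hGD, ← Submodule.coe_sub, h2] at h1
    linarith
  have hconst : ∀ n : ℤ, g (c + (m + n • v)) - G ((c + (m + n • v) : Γ) : V) =
      g (c + m) - G ((c + m : Γ) : V) := by
    intro n
    induction n using Int.induction_on with
    | zero => simp
    | succ i ih => rw [hstep, add_sub_cancel_right, ih]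
    | pred i ih => rw [← hstep, ih]
  have hφ : φ ((c + (m + n • v) : Γ) : V) - φ (c : V) = n := by
    push_cast
    simp [hL m hm, hv]
  have hx : ((c + (m + n • v) : Γ) : V) - (n : ℝ) • (v : V) = ((c + m : Γ) : V) := by
    push_cast
    rw [← Int.cast_smul_eq_zsmul ℝ]
    abel
  rw [hφ, hx, ← hfg m hm, ← hconst n]
  ring

end IsPolynomialOn

end

section

variable {V : Type*} [NormedAddCommGroup V] [InnerProductSpace ℝ V]
  {Γ : Submodule ℤ V} {ι : Type*}

/-! ### Subgroups of finite index -/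

lemma mem_latticeIn {r : Submodule ℝ V} {γ : Γ} : γ ∈ latticeIn Γ r ↔ (γ : V) ∈ r := Iff.rfl

lemma mem_span_image_finset {b : ι → Γ} {J : Finset ι} {x : V} :
    x ∈ Submodule.span ℝ ((fun i => (b i : V)) '' J) ↔
      ∃ c : ι → ℝ, ∑ i ∈ J, c i • (b i : V) = x :=
  Submodule.mem_span_image_finset_iff_exists_fun' ℝ

lemma isQuasiPolynomial_iff {r : Submodule ℝ V} {q : Γ → ℤ} :
    IsQuasiPolynomial r q ↔ (∀ γ : Γ, (γ : V) ∉ r → q γ = 0) ∧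
      ∃ L : AddSubgroup Γ, L ≤ latticeIn Γ r ∧ L.relIndex (latticeIn Γ r) ≠ 0 ∧
        ∀ c ∈ latticeIn Γ r, IsPolynomialOn (fun x => (q x : ℝ)) c L := by
  refine and_congr_right fun _ => exists_congr fun L => and_congr_right fun _ =>
    and_congr_right fun _ => forall₂_congr fun c _ => ?_
  constructor
  · rintro ⟨p, hp⟩
    exact ⟨_, ⟨p, fun _ => rfl⟩, hp⟩
  · rintro ⟨f, ⟨p, hp⟩, hf⟩
    exact ⟨p, fun l hl => (hf l hl).trans (hp _)⟩

section

variable [FiniteDimensional ℝ V] [DiscreteTopology Γ]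

lemma finite_setOf_norm_le (C : ℝ) : {x : Γ | ‖(x : V)‖ ≤ C}.Finite := by
  have : DiscreteTopology Γ.toAddSubgroup := ‹DiscreteTopology Γ›
  have h : ((Γ : Set V) ∩ Metric.closedBall 0 C).Finite := by
    rw [Set.inter_comm]
    refine Metric.finite_isBounded_inter_isClosed DiscreteTopology.isDiscrete
      Metric.isBounded_closedBall ?_
    exact AddSubgroup.isClosed_of_discrete (H := Γ.toAddSubgroup)
  refine Set.Finite.of_finite_image (h.subset ?_) (f := Subtype.val)
    Subtype.val_injective.injOn
  rintro _ ⟨x, hx, rfl⟩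
  exact ⟨x.2, by simpa using hx⟩

lemma relIndex_closure_ne_zero (b : ι → Γ) (J : Finset ι) :
    (AddSubgroup.closure (b '' J)).relIndex
      (latticeIn Γ (Submodule.span ℝ ((fun i => (b i : V)) '' J))) ≠ 0 := by
  set L := AddSubgroup.closure (b '' (J : Set ι)) with hL
  set K := latticeIn Γ (Submodule.span ℝ ((fun i => (b i : V)) '' J)) with hK
  have hT := finite_setOf_norm_le (Γ := Γ) (∑ i ∈ J, ‖(b i : V)‖)
  set T := {x : Γ | ‖(x : V)‖ ≤ ∑ i ∈ J, ‖(b i : V)‖} with hTdef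
  have hTK : Finite {x : K // (x : Γ) ∈ T} := by
    have := hT.to_subtype
    exact Finite.of_injective (β := T) (fun x => ⟨x.1, x.2⟩) fun x y h =>
      Subtype.ext (Subtype.ext (congrArg (fun z : T => (z : Γ)) h))
  have hbL : ∀ i ∈ J, b i ∈ L := fun i hi => AddSubgroup.subset_closure ⟨i, hi, rfl⟩
  have hsurj : Function.Surjective fun x : {x : K // (x : Γ) ∈ T} =>
      (QuotientAddGroup.mk x.1 : K ⧸ L.addSubgroupOf K) := by
    intro q
    induction q using QuotientAddGroup.induction_on with
    | H x =>
    obtain ⟨c, hc⟩ := mem_span_image_finset.1 (mem_latticeIn.1 x.2)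
    have hfl : ∑ i ∈ J, ⌊c i⌋ • b i ∈ L := L.sum_mem fun i hi => L.zsmul_mem (hbL i hi) _
    have hcoe : (((x : Γ) - ∑ i ∈ J, ⌊c i⌋ • b i : Γ) : V) = ∑ i ∈ J, Int.fract (c i) • (b i : V) := by
      push_cast
      rw [← hc, ← Finset.sum_sub_distrib]
      refine Finset.sum_congr rfl fun i _ => ?_
      rw [← Int.cast_smul_eq_zsmul ℝ, ← sub_smul, Int.self_sub_floor]
    refine ⟨⟨⟨(x : Γ) - ∑ i ∈ J, ⌊c i⌋ • b i, ?_⟩, ?_⟩, ?_⟩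
    · refine mem_latticeIn.2 ?_
      rw [hcoe]
      exact mem_span_image_finset.2 ⟨_, rfl⟩
    · change ‖(((x : Γ) - ∑ i ∈ J, ⌊c i⌋ • b i : Γ) : V)‖ ≤ _
      rw [hcoe]
      refine (norm_sum_le _ _).trans (Finset.sum_le_sum fun i _ => ?_)
      rw [norm_smul, Real.norm_of_nonneg (Int.fract_nonneg _)]
      exact mul_le_of_le_one_left (norm_nonneg _) (Int.fract_lt_one _).le
    · rw [QuotientAddGroup.eq, AddSubgroup.mem_addSubgroupOf]
      simpa using hfl
  have : Finite (K ⧸ L.addSubgroupOf K) := Finite.of_surjective _ hsurj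
  exact AddSubgroup.index_ne_zero_of_finite

/-! ### Quasi-polynomials and difference equations -/

lemma isPolynomialOn_closure [DecidableEq ι] {g : Γ → ℝ} {c : Γ} {b : ι → Γ} {J : Finset ι}
    (hJ : LinearIndepOn ℝ (fun i => (b i : V)) (J : Set ι))
    (h : ∀ j ∈ J, IsPolynomialOn (fun x => g x - g (x - b j)) c (AddSubgroup.closure (b '' J))) :
    IsPolynomialOn g c (AddSubgroup.closure (b '' J)) := by
  induction J using Finset.induction_on with
  | empty => simpa using IsPolynomialOn.bot g c
  | insert j J hj ih =>
    have hcl : AddSubgroup.closure (b '' (insert j J : Finset ι)) =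
        AddSubgroup.closure (b '' J) ⊔ AddSubgroup.zmultiples (b j) := by
      rw [Finset.coe_insert, Set.image_insert_eq, ← Set.union_singleton,
        AddSubgroup.closure_union, AddSubgroup.zmultiples_eq_closure]
    rw [hcl] at h ⊢
    have hnot : (b j : V) ∉ Submodule.span ℝ ((fun i => (b i : V)) '' J) := by
      rw [Finset.coe_insert] at hJ
      exact hJ.notMem_span_of_insert hj
    obtain ⟨φ, hφj, hφ⟩ := Submodule.exists_le_ker_of_notMem hnot
    refine IsPolynomialOn.sup_zmultiples (φ := (φ (b j))⁻¹ • φ) ?_ ?_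
      (ih (hJ.mono (by simp)) fun i hi => (h i (Finset.mem_insert_of_mem hi)).mono le_sup_left)
      (h j (Finset.mem_insert_self j J))
    · simp [hφj]
    · intro l hl
      induction hl using AddSubgroup.closure_induction with
      | mem x hx =>
        obtain ⟨i, hi, rfl⟩ := hx
        have : φ (b i : V) = 0 := hφ (Submodule.subset_span ⟨i, hi, rfl⟩)
        simp [this]
      | zero => simp
      | add x y _ _ hx hy =>
        rw [Submodule.coe_add, map_add, hx, hy, add_zero]
      | neg x _ hx => rw [Submodule.coe_neg, map_neg, hx, neg_zero]

lemma isQuasiPolynomial_of_sub [DecidableEq ι] {a : ι → Γ} {s : Finset ι} {q : Γ → ℤ}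
    (hq : ∀ γ : Γ, (γ : V) ∉ spanOf a s → q γ = 0)
    (h : ∀ j ∈ s, IsQuasiPolynomial (spanOf a s) fun x => q x - q (x - a j)) :
    IsQuasiPolynomial (spanOf a s) q := by
  set R := latticeIn Γ (spanOf a s) with hR
  have h' : ∀ j : s, ∃ L : AddSubgroup Γ, L ≤ R ∧ L.relIndex R ≠ 0 ∧
      ∀ c ∈ R, IsPolynomialOn (fun x => (q x : ℝ) - q (x - a j)) c L := fun j => by
    simpa only [Int.cast_sub] using (isQuasiPolynomial_iff.1 (h j j.2)).2
  choose L hLR hLi hLp using h'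
  set L₀ := ⨅ j, L j with hL₀
  have hL₀i : L₀.relIndex R ≠ 0 := AddSubgroup.relIndex_iInf_ne_zero hLi
  set N := (L₀.relIndex R).factorial with hN
  obtain ⟨J, hJs, -, hJspan, hJ⟩ := exists_linearIndepOn_extension (s := ∅) (t := (s : Set ι))
    (v := fun i => (a i : V)) (K := ℝ) (linearIndepOn_empty _ _) (Set.empty_subset _)
  obtain ⟨J, rfl⟩ := (s.finite_toSet.subset hJs).exists_finset_coe
  have haR : ∀ j ∈ s, a j ∈ R := fun j hj => Submodule.subset_span ⟨j, hj, rfl⟩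
  set b : ι → Γ := fun i => N • a i with hb
  have hbcoe : ∀ i, (b i : V) = (N : ℝ) • (a i : V) := fun i => by
    simp [hb, Nat.cast_smul_eq_nsmul]
  have hNR : (N : ℝ) ≠ 0 := Nat.cast_ne_zero.2 (Nat.factorial_ne_zero _)
  have hbL : AddSubgroup.closure (b '' J) ≤ L₀ := by
    rw [AddSubgroup.closure_le]
    rintro _ ⟨i, hi, rfl⟩
    exact (AddSubgroup.nsmul_mem_of_relIndex_ne_zero_of_dvd hL₀i (haR i (hJs hi))
      fun m hm hle => Nat.dvd_factorial hm hle).1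
  have hspan : Submodule.span ℝ ((fun i => (b i : V)) '' J) = spanOf a s := by
    refine le_antisymm (Submodule.span_le.2 ?_) (Submodule.span_le.2 ?_)
    · rintro _ ⟨i, hi, rfl⟩
      simp only [hbcoe]
      exact Submodule.smul_mem _ _ (mem_spanOf a (hJs hi))
    · refine hJspan.trans (Submodule.span_le.2 ?_)
      rintro _ ⟨i, hi, rfl⟩
      have hbi : (b i : V) ∈ Submodule.span ℝ ((fun i => (b i : V)) '' J) :=
        Submodule.subset_span ⟨i, hi, rfl⟩
      have := Submodule.smul_mem _ (N : ℝ)⁻¹ hbi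
      rwa [hbcoe, inv_smul_smul₀ hNR] at this
  refine isQuasiPolynomial_iff.2 ⟨hq, AddSubgroup.closure (b '' J), ?_, ?_, fun c hc => ?_⟩
  · rw [AddSubgroup.closure_le]
    rintro _ ⟨i, hi, rfl⟩
    exact R.nsmul_mem (haR i (hJs hi)) N
  · have := relIndex_closure_ne_zero b J
    rwa [hspan] at this
  · refine isPolynomialOn_closure ?_ fun j hj => ?_
    · set w : ↑(J : Set ι) → ℝˣ := fun _ => Units.mk0 (N : ℝ) hNR with hw
      have hbw : (fun i : (J : Set ι) => (b i : V)) = w • fun i : (J : Set ι) => (a i : V) := by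
        funext i
        rw [hbcoe, Pi.smul_apply', hw, Units.smul_mk0]
      change LinearIndependent ℝ fun i : (J : Set ι) => (b i : V)
      rw [hbw]
      exact LinearIndependent.units_smul hJ w
    · have hjs : j ∈ s := hJs hj
      refine IsPolynomialOn.mono (IsPolynomialOn.sub_nsmul (haR j hjs) (hLp ⟨j, hjs⟩) N c hc) ?_
      exact hbL.trans (iInf_le _ _)

end

end

section

variable {V : Type*} [NormedAddCommGroup V] [InnerProductSpace ℝ V]
  {Γ : Submodule ℤ V} {ι : Type*}

variable [Fintype ι] [DecidableEq ι]

/-! ### Topes -/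

section

variable {a : ι → Γ} {s : Finset ι} {v x : V}

lemma mem_spanOf_of_mem_topeDomain (hx : x ∈ topeDomain a s) : x ∈ spanOf a s := hx.1

lemma tope_subset (a : ι → Γ) (s : Finset ι) (v : V) : tope a s v ⊆ topeDomain a s :=
  connectedComponentIn_subset _ _

lemma mem_tope_self (hv : v ∈ topeDomain a s) : v ∈ tope a s v := mem_connectedComponentIn hv

lemma subset_tope {S : Set V} (hS : IsPreconnected S) (hSD : S ⊆ topeDomain a s) (hxS : x ∈ S)
    (hx : x ∈ tope a s v) : S ⊆ tope a s v := by
  unfold tope at hx ⊢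
  rw [connectedComponentIn_eq hx]
  exact hS.subset_connectedComponentIn hxS hSD

lemma smul_mem_topeDomain (hx : x ∈ topeDomain a s) {t : ℝ} (ht : t ≠ 0) :
    t • x ∈ topeDomain a s := by
  refine ⟨Submodule.smul_mem _ _ hx.1, fun u hu hr h => hx.2 u hu hr ?_⟩
  exact (Submodule.smul_mem_iff _ ht).1 h

lemma smul_mem_tope (hx : x ∈ tope a s v) {t : ℝ} (ht : 0 < t) : t • x ∈ tope a s v := by
  have hpre : IsPreconnected ((fun c : ℝ => c • x) '' Set.Ioi 0) :=
    isPreconnected_Ioi.image _ (by fun_prop)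
  refine subset_tope hpre ?_ ⟨1, by simp, one_smul _ _⟩ hx ⟨t, ht, rfl⟩
  rintro _ ⟨c, hc, rfl⟩
  exact smul_mem_topeDomain (tope_subset a s v hx) (ne_of_gt hc)

lemma exists_ball_subset_tope [FiniteDimensional ℝ V] (hx : x ∈ tope a s v) :
    ∃ ε > 0, ∀ y ∈ spanOf a s, dist y x < ε → y ∈ tope a s v := by
  have hxD := tope_subset a s v hx
  set U : Set V := ⋂ t ∈ {t : Finset ι | t ⊆ s ∧
    Module.finrank ℝ (spanOf a t) + 1 = Module.finrank ℝ (spanOf a s)}, ((spanOf a t : Set V))ᶜ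
    with hU
  have hUo : IsOpen U := (Set.toFinite _).isOpen_biInter fun t _ =>
    (Submodule.closed_of_finiteDimensional _).isOpen_compl
  have hxU : x ∈ U := Set.mem_iInter₂.2 fun t ht => hxD.2 t ht.1 ht.2
  obtain ⟨ε, hε, hball⟩ := Metric.isOpen_iff.1 hUo x hxU
  refine ⟨ε, hε, fun y hy hyx => ?_⟩
  have hconv : Convex ℝ (Metric.ball x ε ∩ (spanOf a s : Set V)) :=
    (convex_ball x ε).inter (spanOf a s).convex
  refine subset_tope hconv.isPreconnected ?_ ⟨Metric.mem_ball_self hε, hxD.1⟩ hx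
    ⟨hyx, hy⟩
  rintro z ⟨hz, hzs⟩
  exact ⟨hzs, fun t ht hr => Set.mem_iInter₂.1 (hball hz) t ⟨ht, hr⟩⟩

lemma exists_mem_tope_of_relIndex_ne_zero [FiniteDimensional ℝ V] (hv : v ∈ topeDomain a s)
    {L : AddSubgroup Γ} (hL : L.relIndex (latticeIn Γ (spanOf a s)) ≠ 0) :
    ∃ l ∈ L, (l : V) ∈ tope a s v := by
  obtain ⟨ε, hε, hball⟩ := exists_ball_subset_tope (mem_tope_self hv)
  obtain ⟨c, hc⟩ := mem_span_image_finset.1 (mem_spanOf_of_mem_topeDomain hv)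
  obtain ⟨n, hn⟩ := exists_nat_gt ((∑ i ∈ s, ‖(a i : V)‖) / ε)
  have hn0 : (0 : ℝ) < n :=
    lt_of_le_of_lt (div_nonneg (Finset.sum_nonneg fun _ _ => norm_nonneg _) hε.le) hn
  set z : Γ := ∑ i ∈ s, ⌊n * c i⌋ • a i with hz
  have hzs : (z : V) ∈ spanOf a s := by
    rw [hz]
    push_cast
    exact Submodule.sum_mem _ fun i hi => Submodule.smul_of_tower_mem _ _ (mem_spanOf a hi)
  have hzt : (z : V) ∈ tope a s v := by
    have h : (n : ℝ)⁻¹ • (z : V) ∈ tope a s v := by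
      refine hball _ (Submodule.smul_mem _ _ hzs) ?_
      have h1 : (n : ℝ) • ((n : ℝ)⁻¹ • (z : V) - v) =
          - ∑ i ∈ s, Int.fract (n * c i) • (a i : V) := by
        rw [smul_sub, smul_inv_smul₀ hn0.ne', ← hc, Finset.smul_sum, hz]
        push_cast
        rw [← Finset.sum_sub_distrib, ← Finset.sum_neg_distrib]
        refine Finset.sum_congr rfl fun i _ => ?_
        rw [← Int.cast_smul_eq_zsmul ℝ, smul_smul, ← sub_smul, ← neg_smul, Int.fract, neg_sub]
      have h2 : n * ‖(n : ℝ)⁻¹ • (z : V) - v‖ ≤ ∑ i ∈ s, ‖(a i : V)‖ := by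
        have h3 := congrArg norm h1
        rw [norm_smul, Real.norm_of_nonneg hn0.le, norm_neg] at h3
        rw [h3]
        refine (norm_sum_le _ _).trans (Finset.sum_le_sum fun i _ => ?_)
        rw [norm_smul, Real.norm_of_nonneg (Int.fract_nonneg _)]
        exact mul_le_of_le_one_left (norm_nonneg _) (Int.fract_lt_one _).le
      rw [dist_eq_norm]
      rw [div_lt_iff₀ hε] at hn
      exact lt_of_mul_lt_mul_left (h2.trans_lt hn) hn0.le
    simpa [smul_inv_smul₀ hn0.ne'] using smul_mem_tope h hn0
  obtain ⟨N, hN, -, hNL⟩ := AddSubgroup.exists_nsmul_mem_of_relIndex_ne_zero hL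
    (mem_latticeIn.2 hzs)
  refine ⟨N • z, hNL.1, ?_⟩
  have := smul_mem_tope hzt (t := N) (by exact_mod_cast hN)
  rwa [Nat.cast_smul_eq_nsmul] at this

lemma IsPolynomialFunction.exists_line {f : V → ℝ} (hf : IsPolynomialFunction f) (x v : V) :
    ∃ S : Polynomial ℝ, ∀ t : ℝ, S.eval t = f (x + t • v) := by
  obtain ⟨p, hp⟩ := hf
  refine ⟨MvPolynomial.aeval (fun φ : Module.Dual ℝ V =>
    Polynomial.C (φ x) + Polynomial.X * Polynomial.C (φ v)) p, fun t => ?_⟩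
  rw [hp]
  clear hp
  induction p using MvPolynomial.induction_on with
  | C c => simp
  | add p q hp hq => simp only [map_add, Polynomial.eval_add, hp, hq]
  | mul_X p ψ hp => simp only [map_mul, Polynomial.eval_mul, hp]; congr 1; simp; ring

lemma IsQuasiPolynomial.eq_zero_of_tope [FiniteDimensional ℝ V] {q : Γ → ℤ}
    (hq : IsQuasiPolynomial (spanOf a s) q) (hv : v ∈ topeDomain a s)
    (h : ∀ γ : Γ, (γ : V) ∈ tope a s v → q γ = 0) : q = 0 := by
  obtain ⟨hq0, L, -, hL, hLp⟩ := isQuasiPolynomial_iff.1 hq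
  obtain ⟨l, hlL, hl⟩ := exists_mem_tope_of_relIndex_ne_zero hv hL
  funext γ
  by_cases hγ : (γ : V) ∈ spanOf a s
  swap
  · exact hq0 γ hγ
  obtain ⟨f, hf, hfq⟩ := hLp γ hγ
  obtain ⟨S, hS⟩ := hf.exists_line (γ : V) (l : V)
  have hSn : ∀ n : ℕ, S.eval (n : ℝ) = q (γ + n • l) := fun n => by
    have := hfq _ (L.nsmul_mem hlL n)
    beta_reduce at this
    rw [hS, this]
    push_cast
    rw [Nat.cast_smul_eq_nsmul]
  obtain ⟨ε, hε, hball⟩ := exists_ball_subset_tope hl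
  obtain ⟨n₀, hn₀⟩ := exists_nat_gt (‖(γ : V)‖ / ε)
  have hroot : ∀ n : ℕ, n₀ ≤ n → S.eval (n : ℝ) = 0 := by
    intro n hn
    have hn' : ‖(γ : V)‖ / ε < n := hn₀.trans_le (by exact_mod_cast hn)
    have hn0 : (0 : ℝ) < n := lt_of_le_of_lt (div_nonneg (norm_nonneg _) hε.le) hn'
    have hmem : (l : V) + (n : ℝ)⁻¹ • (γ : V) ∈ tope a s v := by
      refine hball _ (Submodule.add_mem _ (tope_subset a s v hl).1 (Submodule.smul_mem _ _ hγ)) ?_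
      rw [dist_eq_norm, add_sub_cancel_left, norm_smul, norm_inv, Real.norm_of_nonneg hn0.le,
        inv_mul_lt_iff₀ hn0]
      rwa [div_lt_iff₀ hε] at hn'
    have := smul_mem_tope hmem hn0
    rw [smul_add, smul_inv_smul₀ hn0.ne'] at this
    rw [hSn, h, Int.cast_zero]
    push_cast
    rwa [add_comm, ← Nat.cast_smul_eq_nsmul ℝ]
  have hS0 : S = 0 := by
    refine Polynomial.eq_zero_of_infinite_isRoot S ?_
    refine Set.Infinite.mono ?_ ((Set.Ici_infinite n₀).image (Nat.cast_injective (R := ℝ)).injOn)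
    rintro _ ⟨n, hn, rfl⟩
    exact hroot n hn
  have := hSn 0
  rw [hS0] at this
  simpa using this.symm

lemma IsQuasiPolynomial.sub {r : Submodule ℝ V} {p q : Γ → ℤ} (hp : IsQuasiPolynomial r p)
    (hq : IsQuasiPolynomial r q) : IsQuasiPolynomial r (p - q) := by
  obtain ⟨hp0, L, hLr, hL, hLp⟩ := isQuasiPolynomial_iff.1 hp
  obtain ⟨hq0, M, -, hM, hMq⟩ := isQuasiPolynomial_iff.1 hq
  refine isQuasiPolynomial_iff.2 ⟨fun γ hγ => by simp [hp0 γ hγ, hq0 γ hγ], L ⊓ M,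
    inf_le_left.trans hLr, AddSubgroup.relIndex_inf_ne_zero hL hM, fun c hc => ?_⟩
  obtain ⟨f, hf, hfp⟩ := hLp c hc
  obtain ⟨g, hg, hgq⟩ := hMq c hc
  refine ⟨_, hf.sub hg, fun l hl => ?_⟩
  simp only [Pi.sub_apply, Int.cast_sub, ← hfp l hl.1, ← hgq l hl.2]

lemma subset_sub_zonotope (a : ι → Γ) (s : Finset ι) (τ : Set V) : τ ⊆ τ - zonotope a s :=
  fun x hx => ⟨x, hx, 0, ⟨0, fun _ => by simp, by simp⟩, sub_zero x⟩

lemma isTopePart_unique [FiniteDimensional ℝ V] {r : Submodule ℝ V}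
    (hr : spanOf a (inside a r) = r) (hv : v ∈ topeDomain a (inside a r)) {f p q : Γ → ℤ}
    (hp : IsTopePart a r (tope a (inside a r) v) f p)
    (hq : IsTopePart a r (tope a (inside a r) v) f q) : p = q := by
  have hpq := hp.1.sub hq.1
  rw [← hr] at hpq
  refine sub_eq_zero.1 (hpq.eq_zero_of_tope hv fun γ hγ => ?_)
  have := subset_sub_zonotope a (inside a r) _ hγ
  simp [hp.2 γ this, hq.2 γ this]

end

end

section

variable {V : Type*} [NormedAddCommGroup V] [InnerProductSpace ℝ V]
  {Γ : Submodule ℤ V} {ι : Type*}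

variable [Fintype ι] [DecidableEq ι] [FiniteDimensional ℝ V]

/-! ### Agreement on a whole tope -/

section

variable {a : ι → Γ} {s : Finset ι} {v : V}

lemma exists_coeff_norm_le (a : ι → Γ) (s : Finset ι) :
    ∃ C > 0, ∀ z ∈ spanOf a s, ∃ w : ι → ℝ, z = ∑ i ∈ s, w i • (a i : V) ∧
      ∀ i, |w i| ≤ C * ‖z‖ := by
  set f : (ι → ℝ) →ₗ[ℝ] V := ∑ i ∈ s, (LinearMap.proj i).smulRight (a i : V) with hf
  have hfw : ∀ w, f w = ∑ i ∈ s, w i • (a i : V) := fun w => by simp [hf]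
  obtain ⟨g, hg⟩ := f.rangeRestrict.exists_rightInverse_of_surjective f.range_rangeRestrict
  set G := LinearMap.toContinuousLinearMap g with hG
  refine ⟨‖G‖ + 1, by positivity, fun z hz => ?_⟩
  have hzf : z ∈ f.range := by
    obtain ⟨c, hc⟩ := mem_span_image_finset.1 hz
    exact ⟨c, (hfw c).trans hc⟩
  refine ⟨g ⟨z, hzf⟩, ?_, fun i => ?_⟩
  · rw [← hfw]
    exact (congrArg Subtype.val (LinearMap.congr_fun hg ⟨z, hzf⟩)).symm
  · have h1 : ‖g ⟨z, hzf⟩ i‖ ≤ ‖g ⟨z, hzf⟩‖ := norm_le_pi_norm _ i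
    have h2 : ‖G ⟨z, hzf⟩‖ ≤ ‖G‖ * ‖z‖ := G.le_opNorm _
    rw [Real.norm_eq_abs] at h1
    refine h1.trans (h2.trans ?_)
    gcongr
    linarith

/-- `g` vanishes at the lattice points of `{t} - zonotope a s`. -/
def VanishesAround (a : ι → Γ) (s : Finset ι) (g : Γ → ℤ) (t : V) : Prop :=
  ∀ (c : ι → ℝ), (∀ i, 0 ≤ c i ∧ c i ≤ 1) → ∀ γ : Γ, (γ : V) = t - ∑ i ∈ s, c i • (a i : V) →
    g γ = 0

/-- `g` is invariant under translation by each vector `a j` of `s` at the points where the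
zonotope of the other vectors, put there, meets `τ`. -/
def InvariantNear (a : ι → Γ) (s : Finset ι) (g : Γ → ℤ) (τ : Set V) : Prop :=
  ∀ j ∈ s, ∀ (c : ι → ℝ), (∀ i, 0 ≤ c i ∧ c i ≤ 1) → ∀ γ : Γ,
    (γ : V) + ∑ i ∈ s.erase j, c i • (a i : V) ∈ τ → g γ = g (γ - a j)

lemma VanishesAround.add_smul {g : Γ → ℤ} {τ : Set V} (hg : InvariantNear a s g τ) {t : V}
    (ht : VanishesAround a s g t) {j : ι} (hj : j ∈ s) {w : ℝ} (hw : |w| ≤ 1)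
    (hτ : ∀ z : ℝ, |z| ≤ |w| → t + z • (a j : V) ∈ τ) :
    VanishesAround a s g (t + w • (a j : V)) := by
  intro c hc γ hγ
  obtain ⟨hw1, hw2⟩ := abs_le.1 hw
  obtain ⟨hc0, hc1⟩ := hc j
  have hsum : ∀ d : ℝ, ∑ i ∈ s, Function.update c j d i • (a i : V) =
      d • (a j : V) + ∑ i ∈ s.erase j, c i • (a i : V) := by
    intro d
    rw [← Finset.add_sum_erase _ _ hj, Function.update_self]
    congr 1
    refine Finset.sum_congr rfl fun i hi => ?_
    rw [Function.update_of_ne (Finset.ne_of_mem_erase hi)]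
  have hup : ∀ d : ℝ, 0 ≤ d → d ≤ 1 → ∀ i, 0 ≤ Function.update c j d i ∧
      Function.update c j d i ≤ 1 := by
    intro d hd0 hd1 i
    by_cases hij : i = j
    · subst hij
      simp [hd0, hd1]
    · simpa [hij] using hc i
  rw [← Finset.add_sum_erase _ _ hj] at hγ
  rcases lt_or_ge (c j - w) 0 with h | h
  · have hwpos : 0 < w := by linarith
    have h1 : g γ = g (γ - a j) := by
      refine hg j hj c hc γ ?_
      convert hτ (w - c j) (by rw [abs_of_pos hwpos, abs_of_pos (by linarith)]; linarith) using 1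
      rw [hγ, sub_smul]
      abel
    rw [h1]
    refine ht _ (hup (c j - w + 1) (by linarith) (by linarith)) _ ?_
    rw [hsum, Submodule.coe_sub, hγ, _root_.add_smul, sub_smul, one_smul]
    abel
  · rcases le_or_gt (c j - w) 1 with h' | h'
    · refine ht _ (hup (c j - w) h h') _ ?_
      rw [hsum, hγ, sub_smul]
      abel
    · have hwneg : w < 0 := by linarith
      have h1 : g (γ + a j) = g (γ + a j - a j) := by
        refine hg j hj c hc _ ?_
        convert hτ (w - c j + 1)
          (by rw [abs_of_neg hwneg, abs_of_neg (by linarith)]; linarith) using 1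
        rw [Submodule.coe_add, hγ, _root_.add_smul, sub_smul, one_smul]
        abel
      rw [add_sub_cancel_right] at h1
      rw [← h1]
      refine ht _ (hup (c j - w - 1) (by linarith) (by linarith)) _ ?_
      rw [hsum, Submodule.coe_add, hγ, sub_smul, sub_smul, one_smul]
      abel

lemma VanishesAround.add_sum {g : Γ → ℤ} {τ : Set V} (hg : InvariantNear a s g τ) {t : V}
    (ht : VanishesAround a s g t) (hts : t ∈ spanOf a s) {ρ : ℝ}
    (hτ : ∀ y ∈ spanOf a s, dist y t < ρ → y ∈ τ) {w : ι → ℝ} (hw : ∀ i, |w i| ≤ 1)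
    (hwρ : ∑ i ∈ s, |w i| * ‖(a i : V)‖ < ρ) :
    VanishesAround a s g (t + ∑ i ∈ s, w i • (a i : V)) := by
  suffices h : ∀ J ⊆ s, VanishesAround a s g (t + ∑ i ∈ J, w i • (a i : V)) from h s subset_rfl
  intro J
  induction J using Finset.induction_on with
  | empty => intro _; simpa using ht
  | insert j J hj ih =>
    intro hJ
    have hjs := hJ (Finset.mem_insert_self j J)
    have hJs : J ⊆ s := (Finset.subset_insert j J).trans hJ
    have := (ih hJs).add_smul hg hjs (hw j) fun z hz => ?_
    · rw [Finset.sum_insert hj, add_comm (w j • _), ← add_assoc]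
      exact this
    · refine hτ _ (Submodule.add_mem _ (Submodule.add_mem _ hts (sum_smul_mem_spanOf a hJs w))
        (Submodule.smul_mem _ _ (mem_spanOf a hjs))) (lt_of_le_of_lt ?_ hwρ)
      rw [dist_eq_norm, add_assoc, add_sub_cancel_left]
      calc ‖∑ i ∈ J, w i • (a i : V) + z • (a j : V)‖
          ≤ ∑ i ∈ J, |w i| * ‖(a i : V)‖ + |w j| * ‖(a j : V)‖ := by
            refine (norm_add_le _ _).trans (add_le_add ((norm_sum_le _ _).trans ?_) ?_)
            · simp [norm_smul]
            · rw [norm_smul, Real.norm_eq_abs]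
              gcongr
        _ = ∑ i ∈ insert j J, |w i| * ‖(a i : V)‖ := by rw [Finset.sum_insert hj, add_comm]
        _ ≤ _ := Finset.sum_le_sum_of_subset_of_nonneg hJ fun _ _ _ => by positivity

lemma VanishesAround.of_mem_tope {g : Γ → ℤ} (hg : InvariantNear a s g (tope a s v))
    (hv : v ∈ topeDomain a s) (h : VanishesAround a s g v) {x : V} (hx : x ∈ tope a s v) :
    VanishesAround a s g x := by
  have hpre : IsPreconnected (tope a s v) := isPreconnected_connectedComponentIn
  refine hpre.induction₂' (fun x y => VanishesAround a s g x → VanishesAround a s g y) ?_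
    (fun x y z _ _ _ hxy hyz hx => hyz (hxy hx)) (mem_tope_self hv) hx h
  intro x hx
  obtain ⟨ε, hε, hball⟩ := exists_ball_subset_tope hx
  obtain ⟨C, hC, hcoeff⟩ := exists_coeff_norm_le a s
  set B := ∑ i ∈ s, ‖(a i : V)‖ with hB
  have hB0 : 0 ≤ B := Finset.sum_nonneg fun _ _ => norm_nonneg _
  set δ := min (ε / 2) (min C⁻¹ (ε / (2 * C * (B + 1)))) with hδ
  have hδ0 : 0 < δ := by positivity
  have hδ1 : δ ≤ ε / 2 := min_le_left _ _
  have hδ2 : C * δ ≤ 1 := by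
    have : δ ≤ C⁻¹ := (min_le_right _ _).trans (min_le_left _ _)
    calc C * δ ≤ C * C⁻¹ := by gcongr
      _ = 1 := mul_inv_cancel₀ hC.ne'
  have hδ3 : C * δ * (B + 1) ≤ ε / 2 := by
    have : δ ≤ ε / (2 * C * (B + 1)) := (min_le_right _ _).trans (min_le_right _ _)
    rw [le_div_iff₀ (by positivity)] at this
    linarith
  have key : ∀ t y : V, t ∈ tope a s v → y ∈ tope a s v → dist t x < ε / 2 → dist y t < δ →
      VanishesAround a s g t → VanishesAround a s g y := by
    intro t y htτ hyτ htx hyt ht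
    have hts := (tope_subset a s v htτ).1
    have hys := (tope_subset a s v hyτ).1
    obtain ⟨w, hw, hwC⟩ := hcoeff (y - t) (Submodule.sub_mem _ hys hts)
    rw [dist_eq_norm] at hyt
    have hwδ : ∀ i, |w i| ≤ C * δ := fun i => (hwC i).trans (by gcongr)
    have := ht.add_sum hg hts (ρ := ε / 2) (fun z hz hzt => hball z hz ?_)
      (fun i => (hwδ i).trans hδ2) ?_ (w := w)
    · rwa [← hw, add_sub_cancel] at this
    · linarith [dist_triangle z t x]
    · calc ∑ i ∈ s, |w i| * ‖(a i : V)‖ ≤ ∑ i ∈ s, C * δ * ‖(a i : V)‖ :=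
            Finset.sum_le_sum fun i _ => by gcongr; exact hwδ i
        _ = C * δ * B := by rw [Finset.mul_sum]
        _ < C * δ * (B + 1) := by gcongr; linarith
        _ ≤ ε / 2 := hδ3
  filter_upwards [self_mem_nhdsWithin, mem_nhdsWithin_of_mem_nhds (Metric.ball_mem_nhds x hδ0)]
    with y hyτ hyx
  refine ⟨key x y hx hyτ (by simpa using half_pos hε) hyx, key y x hyτ hx (hyx.trans_le hδ1) ?_⟩
  rw [dist_comm]
  exact hyx

lemma topeDomain_mono {t : Finset ι} (hts : t ⊆ s) (h : spanOf a t = spanOf a s) :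
    topeDomain a s ⊆ topeDomain a t := by
  rintro x ⟨hx, hx'⟩
  exact ⟨h ▸ hx, fun u hu hr => hx' u (hu.trans hts) (h ▸ hr)⟩

lemma tope_mono {t : Finset ι} (hts : t ⊆ s) (h : spanOf a t = spanOf a s) :
    tope a s v ⊆ tope a t v :=
  connectedComponentIn_mono _ (topeDomain_mono hts h)

lemma finrank_spanOf_erase_add_one {j : ι} (h : spanOf a (s.erase j) ≠ spanOf a s) :
    Module.finrank ℝ (spanOf a (s.erase j)) + 1 = Module.finrank ℝ (spanOf a s) := by
  have hle := spanOf_mono a (Finset.erase_subset j s)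
  refine le_antisymm (Submodule.finrank_lt_finrank_of_lt (lt_of_le_of_ne hle h)) ?_
  have hsup : spanOf a s ≤ spanOf a (s.erase j) ⊔ Submodule.span ℝ {(a j : V)} := by
    refine spanOf_le.2 fun i hi => ?_
    by_cases hij : i = j
    · subst hij
      exact Submodule.mem_sup_right (Submodule.mem_span_singleton_self _)
    · exact Submodule.mem_sup_left (mem_spanOf a (Finset.mem_erase.2 ⟨hij, hi⟩))
  refine (Submodule.finrank_mono hsup).trans ((Submodule.finrank_add_le_finrank_add_finrank _ _).trans
    (Nat.add_le_add_left ?_ _))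
  exact (finrank_span_le_card _).trans (by simp)

end

section

variable {a : ι → Γ} {β : V} {F : Submodule ℝ V → Set V}

lemma starProjection_mem_topeDomain (hβ : ∀ r ∈ rationalSubspaces a, IsGeneric a r β)
    (s : Finset ι) : (spanOf a s).starProjection β ∈ topeDomain a s := by
  have hr : spanOf a s ∈ rationalSubspaces a := mem_rationalSubspaces.2 ⟨s, rfl⟩
  have hin : inside a (spanOf a s) = restrictIn a Finset.univ (spanOf a s) := rfl
  refine topeDomain_mono ?_ ?_ (hβ _ hr).1
  · intro i hi
    rw [hin]
    exact mem_restrictIn.2 ⟨Finset.mem_univ i, mem_spanOf a hi⟩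
  · rw [hin]
    exact (spanOf_restrictIn.1 (by rwa [flats_univ])).symm

theorem quasiPart_eq_partitionFunction_of_tope (ha : NoRelation a Finset.univ)
    (hF : OpposesProjections a β F) (hβ : ∀ r ∈ rationalSubspaces a, IsGeneric a r β)
    (s : Finset ι) {γ : Γ}
    (hγ : (γ : V) ∈ tope a s ((spanOf a s).starProjection β) - zonotope a s) :
    quasiPart a F s γ = partitionFunction a s γ := by
  induction hn : s.card using Nat.strong_induction_on generalizing s γ with
  | _ n ih =>
  have hv := starProjection_mem_topeDomain hβ s
  set v := (spanOf a s).starProjection β with hvdef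
  have hinv : InvariantNear a s (fun x => quasiPart a F s x - partitionFunction a s x)
      (tope a s v) := by
    intro j hj c hc x hx
    have h1 := quasiPart_sub ha hF hj x
    have h2 := partitionFunction_sub (ha.mono (Finset.subset_univ s)) hj x
    suffices h : (if spanOf a (s.erase j) = spanOf a s then quasiPart a F (s.erase j) x else 0) =
        partitionFunction a (s.erase j) x by
      beta_reduce
      split_ifs at h h1 <;> linarith
    split_ifs with h
    · refine ih _ (hn ▸ Finset.card_erase_lt_of_mem hj) (s.erase j) ?_ rfl
      rw [h]
      exact ⟨_, tope_mono (Finset.erase_subset j s) h hx, _, ⟨c, hc, rfl⟩, by simp⟩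
    · by_contra hne
      have hxs := mem_spanOf_of_partitionFunction_ne_zero (Ne.symm hne)
      exact (tope_subset a s v hx).2 _ (Finset.erase_subset j s) (finrank_spanOf_erase_add_one h)
        (Submodule.add_mem _ hxs (sum_smul_mem_spanOf a subset_rfl c))
  have hstart : VanishesAround a s (fun x => quasiPart a F s x - partitionFunction a s x) v :=
    fun c hc x hx => sub_eq_zero.2
      (quasiPart_eq_partitionFunction hF ⟨v, rfl, _, ⟨c, hc, rfl⟩, hx.symm⟩)
  obtain ⟨t, ht, _, ⟨c, hc, rfl⟩, h⟩ := hγ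
  exact sub_eq_zero.1 (hstart.of_mem_tope hinv hv ht c hc γ h.symm)

theorem isQuasiPolynomial_quasiPart [DiscreteTopology Γ] (ha : NoRelation a Finset.univ)
    (hF : OpposesProjections a β F) (s : Finset ι) :
    IsQuasiPolynomial (spanOf a s) (quasiPart a F s) := by
  induction hn : s.card using Nat.strong_induction_on generalizing s with
  | _ n ih =>
  refine isQuasiPolynomial_of_sub (fun γ hγ => quasiPart_eq_zero F hγ) fun j hj => ?_
  by_cases h : spanOf a (s.erase j) = spanOf a s
  · rw [show (fun x => quasiPart a F s x - quasiPart a F s (x - a j)) =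
      quasiPart a F (s.erase j) from funext fun x => by rw [quasiPart_sub ha hF hj, if_pos h], ← h]
    exact ih _ (hn ▸ Finset.card_erase_lt_of_mem hj) _ rfl
  · rw [show (fun x => quasiPart a F s x - quasiPart a F s (x - a j)) = 0 from
      funext fun x => by rw [quasiPart_sub ha hF hj, if_neg h, Pi.zero_apply]]
    refine isQuasiPolynomial_iff.2 ⟨fun _ _ => rfl, latticeIn Γ (spanOf a s), le_rfl, ?_,
      fun c _ => ⟨_, IsPolynomialFunction.const 0, fun l _ => by simp⟩⟩
    rw [AddSubgroup.relIndex_self]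
    exact one_ne_zero

/-! ### Faces opposite to the projections -/

lemma opposesProjections_regularFace (hβ : ∀ r ∈ rationalSubspaces a, IsGeneric a r β) :
    OpposesProjections a β fun r => -regularFace a r (rᗮ.starProjection β) := by
  intro r hr i hir
  set u := rᗮ.starProjection β with hu
  have hreg : u ∈ regularVectors a r := (hβ r hr).2
  have hout : i ∈ outside a r := mem_restrictOut (s := Finset.univ).2 ⟨Finset.mem_univ i, hir⟩
  have hself : u ∈ regularFace a r u := mem_connectedComponentIn hreg
  have hpre : IsPreconnected (regularFace a r u) := isPreconnected_connectedComponentIn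
  have hne : ∀ x ∈ regularFace a r u, inner ℝ x (a i : V) ≠ 0 := fun x hx =>
    (connectedComponentIn_subset _ _ hx).2 i hout
  unfold polarize
  split_ifs with h
  · have := h (-u) (by rw [Set.mem_neg, neg_neg]; exact hself)
    rw [inner_neg_left] at this
    rw [Submodule.coe_neg, inner_neg_right]
    exact this
  · push Not at h
    obtain ⟨x, hx, hxi⟩ := h
    rw [Set.mem_neg] at hx
    by_contra! hc
    have hx' : inner ℝ (-x) (a i : V) ≤ 0 := by
      rw [inner_neg_left]
      linarith
    obtain ⟨y, hy, hy0⟩ := hpre.intermediate_value hx hself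
      (f := fun y => inner ℝ y (a i : V)) (by fun_prop) ⟨hx', hc⟩
    exact hne y hy hy0

end

end

end PartFun

theorem theorem3p15 {V : Type*} [NormedAddCommGroup V] [InnerProductSpace ℝ V]
    [FiniteDimensional ℝ V] (Γ : Submodule ℤ V) [DiscreteTopology Γ] [IsZLattice ℝ Γ]
    {m : ℕ} (a : Fin m → Γ) (hne : ∀ i, a i ≠ 0)
    (hspan : PartFun.spanOf a Finset.univ = ⊤)
    (hpointed : PartFun.GeneratesPointedCone a)
    (β : V) (hβ : ∀ r ∈ PartFun.rationalSubspaces a, PartFun.IsGeneric a r β) :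
    (∀ r ∈ PartFun.rationalSubspaces a,
      ∃! q : Γ → ℤ, PartFun.IsTopePart a r
        (PartFun.tope a (PartFun.inside a r) (r.starProjection β))
        (PartFun.partitionFunction a (PartFun.inside a r)) q) ∧
    (∀ r ∈ PartFun.rationalSubspaces a,
      PartFun.ConvolutionDefined
        (PartFun.facePartition a (PartFun.outside a r)
          (-PartFun.regularFace a r (rᗮ.starProjection β)))
        (PartFun.topePart a r (PartFun.tope a (PartFun.inside a r) (r.starProjection β))
          (PartFun.partitionFunction a (PartFun.inside a r)))) ∧
    PartFun.partitionFunction a Finset.univ =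
      ∑ r ∈ PartFun.rationalSubspaces a,
        PartFun.convolution
          (PartFun.facePartition a (PartFun.outside a r)
            (-PartFun.regularFace a r (rᗮ.starProjection β)))
          (PartFun.topePart a r (PartFun.tope a (PartFun.inside a r) (r.starProjection β))
            (PartFun.partitionFunction a (PartFun.inside a r))) := by
  have ha := PartFun.noRelation_of_pointed hne hpointed Finset.univ
  have hF := PartFun.opposesProjections_regularFace hβ
  set F : Submodule ℝ V → Set V := fun r => -PartFun.regularFace a r (rᗮ.starProjection β)
  have hin : ∀ r ∈ PartFun.rationalSubspaces a, PartFun.spanOf a (PartFun.inside a r) = r :=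
    fun r hr => PartFun.spanOf_restrictIn.1 (by rwa [PartFun.flats_univ])
  have hpart : ∀ r ∈ PartFun.rationalSubspaces a, PartFun.IsTopePart a r
      (PartFun.tope a (PartFun.inside a r) (r.starProjection β))
      (PartFun.partitionFunction a (PartFun.inside a r))
      (PartFun.quasiPart a F (PartFun.inside a r)) := by
    intro r hr
    have h1 := PartFun.isQuasiPolynomial_quasiPart ha hF (PartFun.inside a r)
    have h2 := fun γ => PartFun.quasiPart_eq_partitionFunction_of_tope (γ := γ) ha hF hβ
      (PartFun.inside a r)
    rw [hin r hr] at h1 h2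
    exact ⟨h1, h2⟩
  have huniq : ∀ r ∈ PartFun.rationalSubspaces a, ∀ q, PartFun.IsTopePart a r
      (PartFun.tope a (PartFun.inside a r) (r.starProjection β))
      (PartFun.partitionFunction a (PartFun.inside a r)) q →
      q = PartFun.quasiPart a F (PartFun.inside a r) := fun r hr q hq =>
    PartFun.isTopePart_unique (hin r hr) (hβ r hr).1 hq (hpart r hr)
  have htope : ∀ r ∈ PartFun.rationalSubspaces a, PartFun.topePart a r
      (PartFun.tope a (PartFun.inside a r) (r.starProjection β))
      (PartFun.partitionFunction a (PartFun.inside a r)) =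
      PartFun.quasiPart a F (PartFun.inside a r) := fun r hr =>
    huniq r hr _ (Classical.epsilon_spec ⟨_, hpart r hr⟩)
  refine ⟨fun r hr => ⟨_, hpart r hr, huniq r hr⟩, fun r hr => ?_, ?_⟩
  · rw [htope r hr]
    exact hF.convolutionDefined_flat (s := Finset.univ) (by rwa [PartFun.flats_univ])
  · funext γ
    rw [PartFun.partitionFunction_eq_sum_flatTerm a F, PartFun.flats_univ, Finset.sum_apply]
    refine Finset.sum_congr rfl fun r hr => ?_
    rw [htope r hr]
    rfl
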